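/- Let $d\ge 1$ and $s>\frac d2$. Write $\langle\xi\rangle=\sqrt{1+|\xi|^2}$ and $$\Phi_s(z):=\int_{\mathbb R^d}e^{-iz\cdot\xi}\,\frac{d\xi}{\langle\xi\rangle^{2s}}\quad(z\in\mathbb R^d),\qquad \|\Phi_s\|_\infty:=\sup_{z\in\mathbb R^d}|\Phi_s(z)|.$$ Let $E\subset\mathbb R^d$ be a Borel set. $\mathbf P(E)$ denotes the set of Borel probability measures on $E$ with the topology of weak convergence and its Borel $\sigma$-algebra, and $\mathbf P(\mathbf P(E))$ the set of probability measures on $\mathbf P(E)$. For $\rho,\eta\in\mathbf P(E)$ put $$\|\rho-\eta\|_{H^{-s}}^2:=\int_{\mathbb R^d}|\hat\rho(\xi)-\hat\eta(\xi)|^2\,\frac{d\xi}{\langle\xi\rangle^{2s}},\qquad \hat\rho(\xi)=\int_E e^{-ix\cdot\xi}\rho(dx),$$ and for $\alpha,\beta\in\mathbf P(\mathbf P(E))$ $$[\mathcal W_{H^{-s}}(\alpha,\beta)]^2:=\inf_{\gamma\in\Pi(\alpha,\beta)}\int\|\rho-\eta\|_{H^{-s}}^2\,\gamma(d\rho,d\eta),$$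 where $\Pi(\alpha,\beta)$ is the set of probability measures on $\mathbf P(E)\times\mathbf P(E)$ with marginals $\alpha$ and $\beta$. For $\alpha\in\mathbf P(\mathbf P(E))$ and $j\ge1$ let $\alpha_j:=\int_{\mathbf P(E)}\rho^{\otimes j}\,\alpha(d\rho)\in\mathbf P(E^j)$. A sequence $(\pi^j)_{j\ge1}$ with $\pi^j\in\mathbf P(E^j)$ is called symmetric if each $\pi^j$ is invariant under permutations of the $j$ coordinates, and compatible if for all $1\le\ell\le j$ the marginal of $\pi^j$ on the first $\ell$ coordinates is $\pi^\ell$. Let $\hat\pi^j\in\mathbf P(\mathbf P(E))$ be the law of the empirical measure $\frac1j\sum_{i=1}^j\delta_{x_i}$ when $(x_1,\dots,x_j)$ has law $\pi^j$. (1) Let $(\pi^j)_{j\ge1}$ be symmetric and compatible. Then for all $N,M\ge1$ $$[\mathcal W_{H^{-s}}(\hat\pi^N,\hat\pi^M)]^2\le 2\|\Phi_s\|_\infty\Bigl(\frac1M+\frac1N\Bigr),$$ and in particular $(\hat\pi^j)$ is a Cauchy sequence for $\mathcal W_{H^{-s}}$. There is a unique $\pi\in\mathbf P(\mathbf P(E))$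 with $\mathcal W_{H^{-s}}(\hat\pi^j,\pi)\to0$, and $$\mathcal W_{H^{-s}}(\hat\pi^j,\pi)\le\frac{C}{\sqrt j}\qquad(j\ge1)$$ with a constant $C$ depending only on $d$ and $s$. This $\pi$ is characterized by the relations $\pi^j=\pi_j=\int_{\mathbf P(E)}\rho^{\otimes j}\,\pi(d\rho)$ for all $j\ge1$ (it satisfies them and is the only element of $\mathbf P(\mathbf P(E))$ that does), and likewise by the relations $$\int_{E^j}\varphi\,d\pi^j=\int_{\mathbf P(E)}\Bigl(\int_{E^j}\varphi\,d\rho^{\otimes j}\Bigr)\pi(d\rho)\qquad\text{for all } j\ge1,\ \varphi\in C_b(E^j).$$ (2) Conversely, for every $\pi\in\mathbf P(\mathbf P(E))$ the sequence $(\pi_j)_{j\ge1}$, $\pi_j=\int\rho^{\otimes j}\,\pi(d\rho)$, is symmetric and compatible. -/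

import Mathlib

open MeasureTheory Filter Topology
open scoped ENNReal BoundedContinuousFunction

noncomputable section

namespace DeFinetti

variable {d : ℕ}

/-- The bracket `⟨ξ⟩ = √(1 + |ξ|²)`. -/
def bracket (ξ : EuclideanSpace ℝ (Fin d)) : ℝ := √(1 + ‖ξ‖ ^ 2)

/-- `Φ_s(z) = ∫_{ℝ^d} e^{-i z·ξ} ⟨ξ⟩^{-2s} dξ`, written as a complex number (its imaginary part is
zero by the symmetry `ξ ↦ -ξ`, see `Phi_im`). -/
def Phi (s : ℝ) (z : EuclideanSpace ℝ (Fin d)) : ℂ :=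
  ∫ ξ : EuclideanSpace ℝ (Fin d),
    Complex.exp (-(Complex.I * (inner ℝ z ξ : ℝ))) / ((bracket ξ ^ (2 * s) : ℝ) : ℂ)

theorem bracket_neg (ξ : EuclideanSpace ℝ (Fin d)) : bracket (-ξ) = bracket ξ := by
  simp [bracket]

theorem Phi_im (s : ℝ) (z : EuclideanSpace ℝ (Fin d)) : (Phi s z).im = 0 := by
  rw [← Complex.conj_eq_iff_im]
  unfold Phi
  rw [← integral_conj, ← integral_neg_eq_self]
  refine integral_congr_ae (Eventually.of_forall fun ξ => ?_)
  simp only [map_div₀, ← Complex.exp_conj, Complex.conj_ofReal, bracket_neg, map_neg, map_mul,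
    Complex.conj_I, inner_neg_right]
  simp

/-- `Φ_s` is bounded, so that the supremum in `PhiSupNorm` is a genuine one. -/
theorem bddAbove_norm_Phi (d : ℕ) (s : ℝ) :
    BddAbove (Set.range fun z : EuclideanSpace ℝ (Fin d) => ‖Phi s z‖) := by
  refine ⟨∫ ξ : EuclideanSpace ℝ (Fin d), 1 / |bracket ξ ^ (2 * s)|, ?_⟩
  rintro _ ⟨z, rfl⟩
  refine (norm_integral_le_integral_norm _).trans_eq ?_
  refine integral_congr_ae (Eventually.of_forall fun ξ => ?_)
  simp [Complex.norm_exp]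

/-- `‖Φ_s‖_∞`, the supremum norm of `Φ_s` on `ℝ^d`. -/
def PhiSupNorm (d : ℕ) (s : ℝ) : ℝ := ⨆ z : EuclideanSpace ℝ (Fin d), ‖Phi s z‖

variable {E : Set (EuclideanSpace ℝ (Fin d))}

/-- Fourier transform `ρ̂(ξ) = ∫ e^{-i x·ξ} ρ(dx)` of a probability measure on `E ⊆ ℝ^d`. -/
def fourierTransform (ρ : ProbabilityMeasure E) (ξ : EuclideanSpace ℝ (Fin d)) : ℂ :=
  ∫ x : E, Complex.exp (-(Complex.I * (inner ℝ (x : EuclideanSpace ℝ (Fin d)) ξ : ℝ)))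
    ∂(ρ : Measure E)

/-- `‖ρ - η‖²_{H^{-s}} = ∫_{ℝ^d} |ρ̂(ξ) - η̂(ξ)|² ⟨ξ⟩^{-2s} dξ`, as an extended nonnegative real. -/
def sobolevDistSq (s : ℝ) (ρ η : ProbabilityMeasure E) : ℝ≥0∞ :=
  ∫⁻ ξ : EuclideanSpace ℝ (Fin d),
    ENNReal.ofReal (‖fourierTransform ρ ξ - fourierTransform η ξ‖ ^ 2 / bracket ξ ^ (2 * s))

/-- Transference plans: probability measures on the product with prescribed marginals. -/
def couplings {Z : Type*} [MeasurableSpace Z] (α β : ProbabilityMeasure Z) :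
    Set (ProbabilityMeasure (Z × Z)) :=
  {γ | (γ : Measure (Z × Z)).map Prod.fst = α ∧ (γ : Measure (Z × Z)).map Prod.snd = β}

/-- The Monge–Kantorovich–Wasserstein distance `𝒲_{H^{-s}}` on `P(P(E))`, with values in `[0, ∞]`.
Here `P(E)` carries the σ-algebra generated by the evaluations `ρ ↦ ρ(A)`, which on `E ⊆ ℝ^d` is
the Borel σ-algebra of the topology of weak convergence. -/
def sobolevWasserstein (s : ℝ) (α β : ProbabilityMeasure (ProbabilityMeasure E)) : ℝ≥0∞ :=
  (⨅ γ ∈ couplings α β, ∫⁻ p, sobolevDistSq s p.1 p.2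
    ∂(γ : Measure (ProbabilityMeasure E × ProbabilityMeasure E))) ^ (1 / 2 : ℝ)

/-- The empirical measure `μ^N_X = (1/N) ∑ δ_{x_i}`. -/
def empiricalMeasure {N : ℕ} [NeZero N] (X : Fin N → E) : ProbabilityMeasure E :=
  ⟨(N : ℝ≥0∞)⁻¹ • ∑ i, Measure.dirac (X i), ⟨by
    simpa using ENNReal.inv_mul_cancel (Nat.cast_ne_zero.2 (NeZero.ne N))
      (ENNReal.natCast_ne_top N)⟩⟩

theorem measurable_empiricalMeasure {N : ℕ} [NeZero N] :
    Measurable (fun X : Fin N → E => empiricalMeasure X) := by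
  refine Measurable.subtype_mk (Measure.measurable_of_measurable_coe _ fun A hA => ?_)
  simp only [Measure.smul_apply, Measure.finsetSum_apply, smul_eq_mul]
  refine Measurable.const_mul (Finset.measurable_sum _ fun i _ => ?_) _
  exact (Measure.measurable_coe hA).comp (Measure.measurable_dirac.comp (measurable_pi_apply i))

/-- `Ĝ^N ∈ P(P(E))`, the law of the empirical measure under `G^N ∈ P(E^N)`. -/
def empiricalLaw {N : ℕ} [NeZero N] (G : ProbabilityMeasure (Fin N → E)) :
    ProbabilityMeasure (ProbabilityMeasure E) :=
  G.map (f := empiricalMeasure) measurable_empiricalMeasure.aemeasurable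

/-- `ρ^{⊗j}` -/
def tensorPower (j : ℕ) (ρ : ProbabilityMeasure E) : Measure (Fin j → E) :=
  Measure.pi fun _ => (ρ : Measure E)

instance (j : ℕ) (ρ : ProbabilityMeasure E) : IsProbabilityMeasure (tensorPower j ρ) := by
  unfold tensorPower; infer_instance

theorem measurable_tensorPower (j : ℕ) :
    Measurable (fun ρ : ProbabilityMeasure E => tensorPower j ρ) := by
  refine Measurable.measure_of_isPiSystem_of_isProbabilityMeasure generateFrom_pi.symm
    isPiSystem_pi ?_
  rintro _ ⟨A, hA, rfl⟩
  simp only [tensorPower, Measure.pi_pi]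
  refine Finset.measurable_prod _ fun i _ => ?_
  have hi : MeasurableSet (A i) := hA i trivial
  exact (Measure.measurable_coe hi).comp measurable_subtype_coe

/-- The `j`-th marginal `α_j = ∫ ρ^{⊗j} α(dρ)` of a mixture `α ∈ P(P(E))`. -/
def mixtureMarginal (α : ProbabilityMeasure (ProbabilityMeasure E)) (j : ℕ) :
    ProbabilityMeasure (Fin j → E) :=
  ⟨(α : Measure (ProbabilityMeasure E)).bind (tensorPower j),
    isProbabilityMeasure_bind (measurable_tensorPower j).aemeasurable
      (Eventually.of_forall fun _ => inferInstance)⟩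

/-- The monomial function `R_φ(ρ) = ∫ φ dρ^{⊗j}` attached to `φ ∈ C_b(E^j)`. -/
def monomialFun {j : ℕ} (φ : (Fin j → E) →ᵇ ℝ) (ρ : ProbabilityMeasure E) : ℝ :=
  ∫ X, φ X ∂(tensorPower j ρ)

/-- Invariance of a law on `E^j` under permutations of the coordinates. -/
def IsSymmetric {j : ℕ} (G : ProbabilityMeasure (Fin j → E)) : Prop :=
  ∀ σ : Equiv.Perm (Fin j),
    (G : Measure (Fin j → E)).map (fun X i => X (σ i)) = (G : Measure (Fin j → E))

/-- Compatibility: for `1 ≤ ℓ ≤ j`, the marginal of `π^j` on the first `ℓ` coordinates is `π^ℓ`. -/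
def IsCompatible (π : (j : ℕ+) → ProbabilityMeasure (Fin j → E)) : Prop :=
  ∀ (l j : ℕ+) (h : (l : ℕ) ≤ j),
    (π j : Measure (Fin j → E)).map (fun X i => X (Fin.castLE h i)) = (π l : Measure (Fin l → E))

end DeFinetti

end

open DeFinetti

/-!
The heart of the matter is the Hewitt-Savage theorem: a symmetric compatible sequence is of the form
`π^j = ∫ ρ^{⊗j} α(dρ)`. Everything else is read off from the mixing measure `α`.

**Existence of `α`** (`exists_eq_mixtureMarginal`). Extend `(π^j)` to a law `P` on sequences
(`IsCompatible.exists_measure_nat`). Symmetry makes `P` invariant under passing to subsequences. Let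
`k_A(z)` be the conditional probability that `x₀ ∈ A` given `(x₁, x₂, …) = z`. Since
`(x₀, x₁, x₂, …)` and `(x₀, x₂, x₃, …)` have the same law, the conditional probabilities of
`x₀ ∈ A` given the smaller and the larger of the two tails have the same `L²` norm; one is the
conditional expectation of the other, so they agree and `k_A` is shift invariant almost surely
(`IsContractable.directing_shift`). Conditioning on the tails one coordinate at a time then gives
`P(x₀ ∈ A₀, …, x_{j-1} ∈ A_{j-1}) = ∫ ∏ k_{A_i} dP`, so that the law of the random probability
measure `A ↦ k_A` is the mixing measure.

**Rates.** For `X` of law `ρ^{⊗N}` the Fourier transform of the empirical measure is an average of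
`N` independent variables of modulus one, hence at every frequency its mean square distance from `ρ̂`
is at most `1/N` (`lintegral_norm_fourierTransform_empiricalMeasure_sub_le`). Integrating against
`⟨ξ⟩^{-2s}`, whose total mass `Φ_s(0)` is at most `‖Φ_s‖_∞`, bounds the cost of the coupling of the
law of `μ_X` with `α` obtained by drawing `ρ` from `α` and then `X` from `ρ^{⊗N}`. Drawing instead
two conditionally independent samples of sizes `N` and `M` and using `|a - b|² ≤ 2|a|² + 2|b|²`
gives the estimate for `π̂^N` and `π̂^M`.

**Uniqueness.** Two mixing measures with the same marginals have the same moments of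
`ρ ↦ (ρ(A₁), …, ρ(A_n)) ∈ [0,1]^n`, hence coincide by Stone-Weierstrass
(`eq_of_mixtureMarginal_eq`). If `α` and `β` are both `𝒲_{H^{-s}}`-limits of one sequence, cheap
couplings make `ρ̂(ξ)` converge in mean square for almost every `ξ`. Hence the functions
`t ↦ ∫ ∏ ρ̂(t_i) α(dρ)` and `t ↦ ∫ ∏ ρ̂(t_i) β(dρ)`, which are continuous, agree on a dense set,
and they are the characteristic functions of the marginals of `α` and `β`
(`mixtureMarginal_eq_of_tendsto`).
-/

namespace DeFinetti

open ProbabilityTheory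

/-! ### Extension of compatible laws to sequences -/

open Preorder Finset in
/-- Kolmogorov extension over `ℕ` for standard Borel spaces: the Ionescu-Tulcea theorem is applied
to the conditional laws of the last coordinate given the preceding ones. -/
theorem exists_measure_map_frestrictLe {Ω : Type*} [MeasurableSpace Ω] [StandardBorelSpace Ω]
    [Nonempty Ω] (μ : (n : ℕ) → Measure ((i : Iic n) → Ω)) [∀ n, IsProbabilityMeasure (μ n)]
    (hμ : ∀ n, (μ (n + 1)).map (frestrictLe₂ (π := fun _ => Ω) n.le_succ) = μ n) :
    ∃ P : Measure (ℕ → Ω), IsProbabilityMeasure P ∧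
      ∀ n, P.map (frestrictLe (π := fun _ => Ω) n) = μ n := by
  let last (n : ℕ) (y : (i : Iic (n + 1)) → Ω) : Ω := y ⟨n + 1, by simp⟩
  let κ (n : ℕ) : Kernel ((i : Iic n) → Ω) Ω :=
    condDistrib (last n) (frestrictLe₂ (π := fun _ => Ω) n.le_succ) (μ (n + 1))
  let μ₀ : Measure Ω := (μ 0).map (fun y => y ⟨0, by simp⟩)
  have : IsProbabilityMeasure μ₀ :=
    Measure.isProbabilityMeasure_map (measurable_pi_apply _).aemeasurable
  have hκ : ∀ n, IsMarkovKernel (κ n) := fun n => by dsimp only [κ]; infer_instance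
  let P : Measure (ℕ → Ω) := Kernel.trajMeasure (X := fun _ => Ω) μ₀ κ
  have hP : IsProbabilityMeasure P := by dsimp only [P]; infer_instance
  refine ⟨P, hP, fun n => ?_⟩
  induction n with
  | zero =>
    have h0 : P.map (frestrictLe (π := fun _ => Ω) 0) =
        μ₀.map (MeasurableEquiv.piUnique (fun _ : Iic 0 => Ω)).symm := by
      dsimp only [P, Kernel.trajMeasure]
      rw [Measure.map_comp _ _ (by fun_prop), Kernel.traj_map_frestrictLe]
      simp
    rw [h0]
    dsimp only [μ₀]
    rw [Measure.map_map (by fun_prop) (by fun_prop)]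
    convert Measure.map_id
    ext y i
    obtain rfl : i = ⟨0, by simp⟩ := Subsingleton.elim _ _
    rfl
  | succ n ih =>
    -- inverse of splitting off the last coordinate
    let glue (p : ((i : Iic n) → Ω) × Ω) (i : Iic (n + 1)) : Ω :=
      if h : (i : ℕ) ≤ n then p.1 ⟨i, by simpa using h⟩ else p.2
    have hglue : Measurable glue := by
      refine measurable_pi_iff.2 fun i => ?_
      by_cases h : (i : ℕ) ≤ n <;> simp only [glue, h, dite_true, dite_false] <;> fun_prop
    have key := Kernel.map_frestrictLe_trajMeasure_compProd_eq_map_trajMeasure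
      (X := fun _ => Ω) (μ₀ := μ₀) (κ := κ) (a := n)
    change P.map (frestrictLe (π := fun _ => Ω) n) ⊗ₘ κ n =
      P.map (fun x => (frestrictLe (π := fun _ => Ω) n x, x (n + 1))) at key
    have hl : Measurable (last n) := measurable_pi_apply _
    have hfl : Measurable fun y => (frestrictLe₂ (π := fun _ => Ω) n.le_succ y, last n y) :=
      (measurable_frestrictLe₂ (X := fun _ => Ω) _).prodMk hl
    rw [ih, ← hμ n, compProd_map_condDistrib hl.aemeasurable] at key
    have key' := congrArg (Measure.map glue) key
    rw [Measure.map_map hglue hfl,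
      Measure.map_map hglue (by fun_prop)] at key'
    have hi : ∀ i : Iic (n + 1), ¬ (i : ℕ) ≤ n → (⟨n + 1, by simp⟩ : Iic (n + 1)) = i := by
      rintro ⟨i, hi⟩ h
      simp only [mem_Iic] at hi h
      exact Subtype.ext (by simp; omega)
    have e1 : glue ∘ (fun a => (frestrictLe₂ (π := fun _ => Ω) n.le_succ a, last n a)) = id := by
      ext y i
      by_cases h : (i : ℕ) ≤ n
      · simp [glue, h]
      · simp [glue, h, last, hi i h]
    have e2 : glue ∘ (fun x : ℕ → Ω => (frestrictLe (π := fun _ => Ω) n x, x (n + 1))) =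
        frestrictLe (π := fun _ => Ω) (n + 1) := by
      ext y i
      by_cases h : (i : ℕ) ≤ n
      · simp [glue, h]
      · simp [glue, ← hi i h]
    rw [e1, e2, Measure.map_id] at key'
    exact key'.symm

theorem IsCompatible.exists_measure_nat {d : ℕ} {E : Set (EuclideanSpace ℝ (Fin d))}
    (hE : MeasurableSet E) {π : (j : ℕ+) → ProbabilityMeasure (Fin j → E)} (hπ : IsCompatible π) :
    ∃ P : Measure (ℕ → E), IsProbabilityMeasure P ∧
      ∀ j : ℕ+, P.map (fun x (i : Fin j) => x i) = (π j : Measure (Fin j → E)) := by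
  have : StandardBorelSpace E := hE.standardBorel
  have : Nonempty E := by
    obtain ⟨x⟩ := (π 1 : Measure (Fin (1 : ℕ+) → E)).nonempty_of_neZero
    exact ⟨x ⟨0, by simp⟩⟩
  let r (n : ℕ) (x : Fin n.succPNat → E) (i : Finset.Iic n) : E :=
    x ⟨i, Nat.lt_succ_of_le (Finset.mem_Iic.1 i.2)⟩
  let q (n : ℕ) (y : (i : Finset.Iic n) → E) (i : Fin n.succPNat) : E :=
    y ⟨i, Finset.mem_Iic.2 (Nat.le_of_lt_succ i.2)⟩
  have hr (n : ℕ) : Measurable (r n) := measurable_pi_iff.2 fun _ => measurable_pi_apply _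
  have hq (n : ℕ) : Measurable (q n) := measurable_pi_iff.2 fun _ => measurable_pi_apply _
  let μ (n : ℕ) : Measure ((i : Finset.Iic n) → E) := (π n.succPNat : Measure _).map (r n)
  have hμ : ∀ n, IsProbabilityMeasure (μ n) := fun n =>
    Measure.isProbabilityMeasure_map (hr n).aemeasurable
  have hle (n : ℕ) : (n.succPNat : ℕ) ≤ (n + 1).succPNat := Nat.le_succ _
  obtain ⟨P, hP, h⟩ := exists_measure_map_frestrictLe μ fun n => calc
    (μ (n + 1)).map (Preorder.frestrictLe₂ (π := fun _ => E) n.le_succ)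
      = (π (n + 1).succPNat : Measure _).map
          (r n ∘ fun (X : Fin (n + 1).succPNat → E) i => X (Fin.castLE (hle n) i)) :=
        Measure.map_map (Preorder.measurable_frestrictLe₂ (X := fun _ => E) _) (hr _)
    _ = μ n := by
      have hX : Measurable fun (X : Fin (n + 1).succPNat → E) i => X (Fin.castLE (hle n) i) :=
        measurable_pi_iff.2 fun _ => measurable_pi_apply _
      rw [← Measure.map_map (hr n) hX, hπ n.succPNat (n + 1).succPNat (hle n)]
  refine ⟨P, hP, fun j => ?_⟩
  obtain ⟨n, rfl⟩ : ∃ n : ℕ, n.succPNat = j := ⟨j.natPred, PNat.succPNat_natPred j⟩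
  calc P.map (fun x (i : Fin n.succPNat) => x i)
      = (P.map (Preorder.frestrictLe (π := fun _ => E) n)).map (q n) :=
        (Measure.map_map (hq n) (Preorder.measurable_frestrictLe (X := fun _ => E) _)).symm
    _ = ((π n.succPNat : Measure _).map (r n)).map (q n) := congrArg _ (h n)
    _ = (π n.succPNat : Measure _).map (q n ∘ r n) := Measure.map_map (hq n) (hr n)
    _ = π n.succPNat := Measure.map_id

/-! ### Contractable sequences and their directing measure -/

/-- The part of the invariance of a law on sequences under passage to subsequences that de Finetti's
theorem needs: `(x₁, x₂, …)` has the law of the whole sequence, and `(x₀, x₂, x₃, …)` has it too.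
In the latter the tail and the coordinate `x₀` are kept as a pair. -/
structure IsContractable {Ω : Type*} [MeasurableSpace Ω] (P : Measure (ℕ → Ω)) : Prop where
  shift : P.map (fun x n => x (n + 1)) = P
  skip : P.map (fun x => (fun n => x (n + 2), x 0)) = P.map (fun x => (fun n => x (n + 1), x 0))

section

variable {Ω : Type*} [MeasurableSpace Ω] [StandardBorelSpace Ω] [Nonempty Ω]
  {P : Measure (ℕ → Ω)} [IsProbabilityMeasure P]

/-- The directing measure: the regular conditional law of `x₀` given `(x₁, x₂, …)`, as a kernel
evaluated at a sequence standing for this tail. -/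
noncomputable def directing (P : Measure (ℕ → Ω)) [IsProbabilityMeasure P] : Kernel (ℕ → Ω) Ω :=
  condDistrib (fun x => x 0) (fun x n => x (n + 1)) P

instance : IsMarkovKernel (directing P) := by unfold directing; infer_instance

omit [StandardBorelSpace Ω] [Nonempty Ω] [IsProbabilityMeasure P] in
theorem IsContractable.measurePreserving (hP : IsContractable P) :
    MeasurePreserving (fun (x : ℕ → Ω) n => x (n + 1)) P P :=
  ⟨by fun_prop, hP.shift⟩

theorem IsContractable.lintegral_directing (hP : IsContractable P) {A : Set Ω}
    (hA : MeasurableSet A) {g : (ℕ → Ω) → ℝ≥0∞} (hg : Measurable g) :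
    ∫⁻ x, A.indicator 1 (x 0) * g (fun n => x (n + 1)) ∂P = ∫⁻ x, directing P x A * g x ∂P := by
  have h := compProd_map_condDistrib (mβ := inferInstance) (μ := P) (Y := fun x : ℕ → Ω => x 0)
    (X := fun x n => x (n + 1)) (measurable_pi_apply 0).aemeasurable
  rw [hP.shift] at h
  have h1 : Measurable (A.indicator (1 : Ω → ℝ≥0∞)) := measurable_one.indicator hA
  have hm : Measurable fun p : (ℕ → Ω) × Ω => A.indicator (1 : Ω → ℝ≥0∞) p.2 * g p.1 := by
    fun_prop
  calc _ = ∫⁻ p, A.indicator 1 p.2 * g p.1 ∂(P.map fun x => (fun n => x (n + 1), x 0)) := by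
        rw [lintegral_map hm (by fun_prop)]
    _ = ∫⁻ p, A.indicator 1 p.2 * g p.1 ∂(P ⊗ₘ directing P) := by rw [← h]; rfl
    _ = _ := by
      rw [Measure.lintegral_compProd hm]
      refine lintegral_congr fun x => ?_
      dsimp only
      rw [lintegral_mul_const _ h1, lintegral_indicator_one hA]

/-- The directing measure is shift invariant. Evaluated at the shifts `S x` and `S² x` of a sequence,
it gives the conditional probabilities of `x₀ ∈ A` given two nested tails, whose difference vanishes
in `L²` because their norms agree. -/
theorem IsContractable.directing_shift (hP : IsContractable P) {A : Set Ω}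
    (hA : MeasurableSet A) :
    (fun x => directing P (fun n => x (n + 1)) A) =ᵐ[P] fun x => directing P x A := by
  have hk : Measurable fun x => directing P x A := Kernel.measurable_coe _ hA
  set k : (ℕ → Ω) → ℝ≥0∞ := fun x => directing P x A with hkdef
  have hk1 : ∀ x, k x ≤ 1 := fun x => prob_le_one
  have hS : Measurable fun (x : ℕ → Ω) n => x (n + 1) := by fun_prop
  have h1 : Measurable (A.indicator (1 : Ω → ℝ≥0∞)) := measurable_one.indicator hA
  have hm : Measurable fun p : (ℕ → Ω) × Ω => A.indicator (1 : Ω → ℝ≥0∞) p.2 * k p.1 := by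
    fun_prop
  -- by conditioning both integrals become integrals of the indicator of `x₀ ∈ A`, against
  -- `k (S² x)` on the left and `k (S x)` on the right
  have cross : ∫⁻ x, k x * k (fun n => x (n + 1)) ∂P = ∫⁻ x, k x * k x ∂P := by
    have e1 := hP.lintegral_directing hA hk
    have e2 := hP.lintegral_directing hA (hk.comp hS)
    simp only [Function.comp_def] at e2
    refine e2.symm.trans (Eq.trans ?_ e1)
    have := congrArg (fun ν => ∫⁻ p, A.indicator 1 p.2 * k p.1 ∂ν) hP.skip
    simpa only [lintegral_map hm (show Measurable fun x : ℕ → Ω => (fun n => x (n + 2), x 0) by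
      fun_prop), lintegral_map hm (show Measurable fun x : ℕ → Ω => (fun n => x (n + 1), x 0) by
      fun_prop)] using this
  have stat : ∫⁻ x, k (fun n => x (n + 1)) * k (fun n => x (n + 1)) ∂P = ∫⁻ x, k x * k x ∂P :=
    hP.measurePreserving.lintegral_comp (hk.mul hk)
  have fin : ∀ {f g : (ℕ → Ω) → ℝ≥0∞}, (∀ x, f x ≤ 1) → (∀ x, g x ≤ 1) → Measurable f →
      Measurable g → Integrable (fun x => (f x).toReal * (g x).toReal) P ∧
      ∫ x, (f x).toReal * (g x).toReal ∂P = (∫⁻ x, f x * g x ∂P).toReal := by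
    intro f g hf hg mf mg
    constructor
    · refine Integrable.of_bound (by fun_prop) 1 (ae_of_all _ fun x => ?_)
      rw [← ENNReal.toReal_mul, Real.norm_of_nonneg ENNReal.toReal_nonneg]
      exact ENNReal.toReal_le_of_le_ofReal one_pos.le (by simpa using mul_le_one' (hf x) (hg x))
    · rw [← integral_toReal (by fun_prop) (ae_of_all _ fun x =>
        (mul_le_one' (hf x) (hg x)).trans_lt ENNReal.one_lt_top)]
      simp only [ENNReal.toReal_mul]
  obtain ⟨i1, e1⟩ := fin hk1 (fun x => hk1 _) hk (hk.comp hS)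
  obtain ⟨i2, e2⟩ := fin (fun x => hk1 _) (fun x => hk1 _) (hk.comp hS) (hk.comp hS)
  obtain ⟨i3, e3⟩ := fin hk1 hk1 hk hk
  have hint : Integrable (fun x => ((k fun n => x (n + 1)).toReal - (k x).toReal) ^ 2) P :=
    ((i2.sub (i1.const_mul 2)).add i3).congr (ae_of_all _ fun x => by
      simp only [Pi.add_apply, Pi.sub_apply]; ring)
  have hzero : ∫ x, ((k fun n => x (n + 1)).toReal - (k x).toReal) ^ 2 ∂P = 0 := by
    calc _ = ∫ x, ((k fun n => x (n + 1)).toReal * (k fun n => x (n + 1)).toReal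
            - 2 * ((k x).toReal * (k fun n => x (n + 1)).toReal))
            + (k x).toReal * (k x).toReal ∂P := by congr 1; ext x; ring
      _ = 0 := by
        rw [integral_add (by exact i2.sub (i1.const_mul 2)) i3, integral_sub i2 (i1.const_mul 2),
          integral_const_mul, e1, e2, e3, cross, stat]
        ring
  filter_upwards [(integral_eq_zero_iff_of_nonneg (fun x => sq_nonneg _) hint).1 hzero] with x hx
  exact (ENNReal.toReal_eq_toReal_iff' ((hk1 _).trans_lt ENNReal.one_lt_top).ne
    ((hk1 _).trans_lt ENNReal.one_lt_top).ne).1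
      (sub_eq_zero.1 (pow_eq_zero_iff two_ne_zero |>.1 hx))

/-- Given any shift invariant function `g`, the coordinates are conditionally independent with
the directing measure as their common law. The coordinate `x₀` is integrated out first, and its
conditional probability, being invariant, is absorbed into `g`. -/
theorem IsContractable.lintegral_prod_indicator (hP : IsContractable P) (j : ℕ)
    {A : ℕ → Set Ω} (hA : ∀ i, MeasurableSet (A i)) {g : (ℕ → Ω) → ℝ≥0∞} (hg : Measurable g)
    (hgS : (fun x => g fun n => x (n + 1)) =ᵐ[P] g) :
    ∫⁻ x, (∏ i ∈ Finset.range j, (A i).indicator 1 (x i)) * g x ∂P =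
      ∫⁻ x, (∏ i ∈ Finset.range j, directing P x (A i)) * g x ∂P := by
  induction j generalizing A g with
  | zero => simp
  | succ j ih =>
    have hk : ∀ i, Measurable fun x => directing P x (A i) := fun i =>
      Kernel.measurable_coe _ (hA i)
    have h1 : ∀ i, Measurable ((A i).indicator (1 : Ω → ℝ≥0∞)) := fun i =>
      measurable_one.indicator (hA i)
    calc _ = ∫⁻ x, (A 0).indicator 1 (x 0) *
          ((∏ i ∈ Finset.range j, (A (i + 1)).indicator 1 (x (i + 1))) *
            g fun n => x (n + 1)) ∂P := by
          refine lintegral_congr_ae (hgS.mono fun x hx => ?_)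
          dsimp only at hx ⊢
          rw [hx, Finset.prod_range_succ']
          ring
      _ = ∫⁻ x, directing P x (A 0) *
          ((∏ i ∈ Finset.range j, (A (i + 1)).indicator 1 (x i)) * g x) ∂P :=
          hP.lintegral_directing (hA 0)
            (g := fun x => (∏ i ∈ Finset.range j, (A (i + 1)).indicator 1 (x i)) * g x)
            (by fun_prop)
      _ = ∫⁻ x, (∏ i ∈ Finset.range j, (A (i + 1)).indicator 1 (x i)) *
          (directing P x (A 0) * g x) ∂P := lintegral_congr fun x => by ring
      _ = ∫⁻ x, (∏ i ∈ Finset.range j, directing P x (A (i + 1))) *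
          (directing P x (A 0) * g x) ∂P := by
          refine ih (fun i => hA (i + 1)) ((hk 0).mul hg) ?_
          filter_upwards [hP.directing_shift (hA 0), hgS] with x h h'
          rw [h, h']
      _ = _ := by simp_rw [Finset.prod_range_succ', mul_assoc]

end

/-! ### The Hewitt-Savage theorem -/

variable {d : ℕ} {E : Set (EuclideanSpace ℝ (Fin d))}

/-- On finitely many coordinates an injective selection of indices is the restriction of a
permutation, under which the marginals are invariant. -/
theorem isContractable_of_isSymmetric {π : (j : ℕ+) → ProbabilityMeasure (Fin j → E)}
    (hs : ∀ j, IsSymmetric (π j)) {P : Measure (ℕ → E)} [IsProbabilityMeasure P]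
    (hP : ∀ j : ℕ+, P.map (fun x (i : Fin j) => x i) = (π j : Measure (Fin j → E))) :
    IsContractable P := by
  have key : ∀ e : ℕ → ℕ, Function.Injective e → P.map (fun x n => x (e n)) = P := by
    intro e he
    refine IsProjectiveLimit.unique (P := fun I => P.map I.restrict) (fun I => ?_) fun I => rfl
    rw [Measure.map_map (by fun_prop) (by fun_prop)]
    -- a finite block containing `I` and `e '' I`, on which `e` extends to a permutation
    obtain ⟨m, hm⟩ : ∃ m : ℕ, ∀ i ∈ I, i < m + 1 ∧ e i < m + 1 :=
      ⟨I.sup id + I.sup e, fun i hi => by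
        have := Finset.le_sup (f := id) hi
        have := Finset.le_sup (f := e) hi
        simp only [id] at *
        omega⟩
    let j : ℕ+ := m.succPNat
    let a : I → Fin j := fun i => ⟨i, (hm i i.2).1⟩
    let b : I → Fin j := fun i => ⟨e i, (hm i i.2).2⟩
    have ha : Function.Injective a := fun x y h => Subtype.ext (congrArg Fin.val h)
    have hb : Function.Injective b := fun x y h => Subtype.ext (he (congrArg Fin.val h))
    let σ₀ : Set.range a ≃ Set.range b :=
      (Equiv.ofInjective a ha).symm.trans (Equiv.ofInjective b hb)
    let σ : Equiv.Perm (Fin j) := σ₀.extendSubtype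
    have hσ : ∀ i, σ (a i) = b i := fun i => by
      have := Equiv.extendSubtype_apply_of_mem σ₀ (a i) ⟨i, rfl⟩
      simp only [σ]
      rw [this]
      simp [σ₀]
    have hab : Measurable fun (y : Fin j → E) (i : I) => y (a i) := by fun_prop
    have hbb : Measurable fun (y : Fin j → E) (i : I) => y (σ (a i)) := by fun_prop
    calc _ = (P.map fun x (i : Fin j) => x i).map (fun y (i : I) => y (σ (a i))) := by
          rw [Measure.map_map hbb (by fun_prop)]
          simp only [hσ]
          rfl
      _ = ((π j : Measure (Fin j → E)).map fun y i => y (σ i)).map (fun y (i : I) => y (a i)) := by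
          rw [hP j, Measure.map_map hab (by fun_prop)]
          rfl
      _ = (P.map fun x (i : Fin j) => x i).map (fun y (i : I) => y (a i)) := by
          rw [hs j σ, hP j]
      _ = _ := by
          rw [Measure.map_map hab (by fun_prop)]
          rfl
  refine ⟨key _ (add_left_injective 1), ?_⟩
  -- the selection that skips the index `1`
  have h := key (fun n => if n = 0 then 0 else n + 1) fun x y h => by
    dsimp only at h
    split_ifs at h <;> omega
  conv_rhs => rw [← h]
  rw [Measure.map_map (by fun_prop) (by fun_prop)]
  rfl

theorem mixtureMarginal_univ_pi (α : ProbabilityMeasure (ProbabilityMeasure E)) {j : ℕ}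
    {A : Fin j → Set E} (hA : ∀ i, MeasurableSet (A i)) :
    (mixtureMarginal α j : Measure (Fin j → E)) (Set.univ.pi A) =
      ∫⁻ ρ, ∏ i, (ρ : Measure E) (A i) ∂(α : Measure (ProbabilityMeasure E)) := by
  simp only [mixtureMarginal, ProbabilityMeasure.coe_mk]
  rw [Measure.bind_apply (MeasurableSet.univ_pi hA) (measurable_tensorPower j).aemeasurable]
  simp [tensorPower, Measure.pi_pi]

theorem measure_eq_mixtureMarginal {α : ProbabilityMeasure (ProbabilityMeasure E)} {j : ℕ}
    {G : ProbabilityMeasure (Fin j → E)}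
    (h : ∀ A : Fin j → Set E, (∀ i, MeasurableSet (A i)) →
      (G : Measure (Fin j → E)) (Set.univ.pi A) =
        ∫⁻ ρ, ∏ i, (ρ : Measure E) (A i) ∂(α : Measure (ProbabilityMeasure E))) :
    G = mixtureMarginal α j := by
  refine Subtype.ext (ext_of_generate_finite (μ := (G : Measure (Fin j → E)))
    (ν := (mixtureMarginal α j : Measure (Fin j → E))) _ generateFrom_pi.symm isPiSystem_pi ?_ ?_)
  · rintro _ ⟨A, hA, rfl⟩
    have hA' : ∀ i, MeasurableSet (A i) := fun i => hA i trivial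
    exact (h A hA').trans (mixtureMarginal_univ_pi α hA').symm
  · exact (measure_univ (μ := (G : Measure (Fin j → E)))).trans
      (measure_univ (μ := (mixtureMarginal α j : Measure (Fin j → E)))).symm

/-- The Hewitt-Savage theorem: the laws of an exchangeable sequence are mixtures of tensor powers,
the mixing measure being the law of the directing measure. -/
theorem exists_eq_mixtureMarginal (hE : MeasurableSet E)
    {π : (j : ℕ+) → ProbabilityMeasure (Fin j → E)}
    (hs : ∀ j, IsSymmetric (π j)) (hc : IsCompatible π) :
    ∃ α : ProbabilityMeasure (ProbabilityMeasure E), ∀ j : ℕ+, π j = mixtureMarginal α j := by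
  have : StandardBorelSpace E := hE.standardBorel
  obtain ⟨P, hP, hPπ⟩ := hc.exists_measure_nat hE
  have : Nonempty E := (nonempty_of_isProbabilityMeasure P).map fun x => x 0
  have hcon := isContractable_of_isSymmetric hs hPπ
  let D : (ℕ → E) → ProbabilityMeasure E := fun x => ⟨directing P x, inferInstance⟩
  have hD : Measurable D := (directing P).measurable.subtype_mk
  let α : ProbabilityMeasure (ProbabilityMeasure E) :=
    ⟨P.map D, Measure.isProbabilityMeasure_map hD.aemeasurable⟩
  refine ⟨α, fun j => measure_eq_mixtureMarginal fun A hA => ?_⟩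
  let A' : ℕ → Set E := fun i => if h : i < j then A ⟨i, h⟩ else Set.univ
  have hA' : ∀ i, MeasurableSet (A' i) := fun i => by
    dsimp only [A']; split_ifs; exacts [hA _, MeasurableSet.univ]
  have hAA : ∀ i : Fin j, A' i = A i := fun i => by simp [A']
  have hm : Measurable fun ρ : ProbabilityMeasure E => ∏ i, (ρ : Measure E) (A i) :=
    Finset.measurable_prod _ fun i _ =>
      (Measure.measurable_coe (hA i)).comp measurable_subtype_coe
  have key := hcon.lintegral_prod_indicator j hA' (g := 1) measurable_one (by rfl)
  simp only [Pi.one_apply, mul_one, Finset.prod_range, hAA] at key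
  calc (π j : Measure (Fin j → E)) (Set.univ.pi A)
      = P ((fun x (i : Fin j) => x i) ⁻¹' Set.univ.pi A) := by
        rw [← hPπ j, Measure.map_apply (by fun_prop) (MeasurableSet.univ_pi hA)]
    _ = ∫⁻ x, ∏ i : Fin j, (A i).indicator 1 (x i) ∂P := by
        rw [← lintegral_indicator_one ((MeasurableSet.univ_pi hA).preimage (by fun_prop))]
        refine lintegral_congr fun x => ?_
        by_cases hx : ∀ i : Fin j, x i ∈ A i
        · simp [Set.indicator, hx]
        · rw [Set.indicator_of_notMem (by simpa using hx)]
          obtain ⟨i, hi⟩ := not_forall.1 hx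
          exact (Finset.prod_eq_zero (Finset.mem_univ i) (by simp [hi])).symm
    _ = ∫⁻ x, ∏ i : Fin j, directing P x (A i) ∂P := key
    _ = _ := (lintegral_map (μ := P) hm hD).symm

/-! ### Fourier transforms of empirical measures -/

theorem norm_fourierTransform_le_one (ρ : ProbabilityMeasure E) (ξ : EuclideanSpace ℝ (Fin d)) :
    ‖fourierTransform ρ ξ‖ ≤ 1 := by
  refine (norm_integral_le_integral_norm _).trans ?_
  simp [Complex.norm_exp]

theorem measurable_fourierTransform :
    Measurable fun p : ProbabilityMeasure E × EuclideanSpace ℝ (Fin d) =>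
      fourierTransform p.1 p.2 := by
  let κ : Kernel (ProbabilityMeasure E × EuclideanSpace ℝ (Fin d)) E :=
    ⟨fun p => (p.1 : Measure E), measurable_subtype_coe.comp measurable_fst⟩
  have : IsMarkovKernel κ := ⟨fun p => p.1.2⟩
  exact (StronglyMeasurable.integral_kernel_prod_right' (κ := κ)
    (f := fun q => Complex.exp
      (-(Complex.I * (inner ℝ (q.2 : EuclideanSpace ℝ (Fin d)) q.1.2 : ℝ))))
    (Measurable.stronglyMeasurable (by fun_prop))).measurable

theorem continuous_fourierTransform (ρ : ProbabilityMeasure E) :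
    Continuous (fourierTransform ρ) := by
  refine continuous_of_dominated (bound := fun _ => 1) (fun ξ => ?_)
    (fun ξ => ae_of_all _ fun x => ?_) (integrable_const _) (ae_of_all _ fun x => by fun_prop)
  · exact Measurable.aestronglyMeasurable (by fun_prop)
  · simp [Complex.norm_exp]

theorem fourierTransform_eq_cos_sub_sin (ρ : ProbabilityMeasure E)
    (ξ : EuclideanSpace ℝ (Fin d)) :
    fourierTransform ρ ξ =
      (∫ x : E, Real.cos (inner ℝ (x : EuclideanSpace ℝ (Fin d)) ξ) ∂(ρ : Measure E) : ℝ) -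
      (∫ x : E, Real.sin (inner ℝ (x : EuclideanSpace ℝ (Fin d)) ξ) ∂(ρ : Measure E) : ℝ)
        * Complex.I := by
  have h1 : Integrable (fun x : E => Real.cos (inner ℝ (x : EuclideanSpace ℝ (Fin d)) ξ))
      (ρ : Measure E) :=
    Integrable.of_bound (Measurable.aestronglyMeasurable (by fun_prop)) 1
      (ae_of_all _ fun x => by simpa using Real.abs_cos_le_one _)
  have h2 : Integrable (fun x : E => Real.sin (inner ℝ (x : EuclideanSpace ℝ (Fin d)) ξ))
      (ρ : Measure E) :=
    Integrable.of_bound (Measurable.aestronglyMeasurable (by fun_prop)) 1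
      (ae_of_all _ fun x => by simpa using Real.abs_sin_le_one _)
  rw [← integral_complex_ofReal, ← integral_complex_ofReal, ← integral_mul_const,
    ← integral_sub h1.ofReal (h2.ofReal.mul_const _)]
  refine integral_congr_ae (ae_of_all _ fun x => ?_)
  simp only
  rw [show -(Complex.I * ((inner ℝ (x : EuclideanSpace ℝ (Fin d)) ξ : ℝ) : ℂ)) =
    ((-(inner ℝ (x : EuclideanSpace ℝ (Fin d)) ξ) : ℝ) : ℂ) * Complex.I by push_cast; ring,
    Complex.exp_mul_I, ← Complex.ofReal_cos, ← Complex.ofReal_sin]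
  simp [sub_eq_add_neg]

theorem norm_sq_ofReal_sub_mul_I (a b : ℝ) : ‖(a : ℂ) - b * Complex.I‖ ^ 2 = a ^ 2 + b ^ 2 := by
  rw [Complex.sq_norm, Complex.normSq_apply]
  simp
  ring

theorem integral_empiricalMeasure {N : ℕ} [NeZero N] (X : Fin N → E) {f : E → ℝ} :
    ∫ x, f x ∂(empiricalMeasure X : Measure E) = (N : ℝ)⁻¹ * ∑ i, f (X i) := by
  simp only [empiricalMeasure, ProbabilityMeasure.coe_mk]
  rw [integral_smul_measure, integral_finsetSum_measure fun i _ => integrable_dirac (by simp)]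
  simp

/-- The weak law of large numbers in `L²`: the variance of the empirical mean of `f` is `1/N` times
the variance of `f`. -/
theorem integral_sq_empiricalMeasure_sub_le {N : ℕ} [NeZero N] (ρ : ProbabilityMeasure E)
    {f : E → ℝ} (hf : Measurable f) (hb : ∀ x, |f x| ≤ 1) :
    Integrable (fun X => (∫ x, f x ∂(empiricalMeasure X : Measure E) -
      ∫ x, f x ∂(ρ : Measure E)) ^ 2) (tensorPower N ρ) ∧
    ∫ X, (∫ x, f x ∂(empiricalMeasure X : Measure E) - ∫ x, f x ∂(ρ : Measure E)) ^ 2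
      ∂(tensorPower N ρ) ≤ (N : ℝ)⁻¹ * ∫ x, f x ^ 2 ∂(ρ : Measure E) := by
  have hN : (N : ℝ) ≠ 0 := Nat.cast_ne_zero.2 (NeZero.ne N)
  have hL : MemLp f 2 (ρ : Measure E) :=
    MemLp.of_bound hf.aestronglyMeasurable 1 (ae_of_all _ fun x => by simpa using hb x)
  have hLi : ∀ i : Fin N, MemLp (fun X : Fin N → E => f (X i)) 2 (tensorPower N ρ) := fun i =>
    hL.comp_measurePreserving (measurePreserving_eval _ i)
  have hS : MemLp (fun X : Fin N → E => ∑ i, f (X i)) 2 (tensorPower N ρ) :=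
    memLp_finsetSum _ fun i _ => hLi i
  have hmean : ∫ X, ∑ i, f (X i) ∂(tensorPower N ρ) = N * ∫ x, f x ∂(ρ : Measure E) := by
    rw [integral_finsetSum _ fun i _ => (hLi i).integrable (by norm_num)]
    have : ∀ i : Fin N, ∫ X, f (X i) ∂(tensorPower N ρ) = ∫ x, f x ∂(ρ : Measure E) := fun i =>
      integral_comp_eval (μ := fun _ : Fin N => (ρ : Measure E)) (i := i) hf.aestronglyMeasurable
    simp [this]
  have hvar : Var[fun X : Fin N → E => ∑ i, f (X i); tensorPower N ρ] =
      N * Var[f; (ρ : Measure E)] := by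
    have := variance_sum_pi (μ := fun _ : Fin N => (ρ : Measure E)) (X := fun _ => f)
      fun _ => hL
    rw [Finset.sum_fn] at this
    simpa [tensorPower] using this
  have hpt : ∀ X : Fin N → E, (∫ x, f x ∂(empiricalMeasure X : Measure E) -
      ∫ x, f x ∂(ρ : Measure E)) ^ 2 =
      ((N : ℝ)⁻¹) ^ 2 * (∑ i, f (X i) - ∫ X, ∑ i, f (X i) ∂(tensorPower N ρ)) ^ 2 := fun X => by
    rw [integral_empiricalMeasure, hmean]
    field_simp
  simp only [hpt]
  refine ⟨((hS.sub (memLp_const _)).integrable_sq).const_mul _, ?_⟩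
  rw [integral_const_mul, ← variance_eq_integral hS.aemeasurable, hvar]
  have := variance_le_expectation_sq (μ := (ρ : Measure E)) hf.aestronglyMeasurable
  calc _ = (N : ℝ)⁻¹ * Var[f; (ρ : Measure E)] := by field_simp
    _ ≤ _ := by
      refine mul_le_mul_of_nonneg_left ?_ (by positivity)
      simpa using this

/-- The cosine and sine parts of the empirical Fourier transform have variances that add up to at
most `(1/N) ∫ (cos² + sin²) dρ = 1/N`. -/
theorem lintegral_norm_fourierTransform_empiricalMeasure_sub_le {N : ℕ} [NeZero N]
    (ρ : ProbabilityMeasure E) (ξ : EuclideanSpace ℝ (Fin d)) :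
    ∫⁻ X, ENNReal.ofReal (‖fourierTransform (empiricalMeasure X) ξ - fourierTransform ρ ξ‖ ^ 2)
      ∂(tensorPower N ρ) ≤ ENNReal.ofReal (1 / N) := by
  obtain ⟨i1, h1⟩ := integral_sq_empiricalMeasure_sub_le (N := N) ρ
    (f := fun x : E => Real.cos (inner ℝ (x : EuclideanSpace ℝ (Fin d)) ξ)) (by fun_prop)
    fun x => Real.abs_cos_le_one _
  obtain ⟨i2, h2⟩ := integral_sq_empiricalMeasure_sub_le (N := N) ρ
    (f := fun x : E => Real.sin (inner ℝ (x : EuclideanSpace ℝ (Fin d)) ξ)) (by fun_prop)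
    fun x => Real.abs_sin_le_one _
  have j1 : Integrable (fun x : E => Real.cos (inner ℝ (x : EuclideanSpace ℝ (Fin d)) ξ) ^ 2)
      (ρ : Measure E) :=
    Integrable.of_bound (Measurable.aestronglyMeasurable (by fun_prop)) 1
      (ae_of_all _ fun x => by simpa using Real.abs_cos_le_one _)
  have j2 : Integrable (fun x : E => Real.sin (inner ℝ (x : EuclideanSpace ℝ (Fin d)) ξ) ^ 2)
      (ρ : Measure E) :=
    Integrable.of_bound (Measurable.aestronglyMeasurable (by fun_prop)) 1
      (ae_of_all _ fun x => by simpa using Real.abs_sin_le_one _)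
  have hpt : ∀ X : Fin N → E,
      ‖fourierTransform (empiricalMeasure X) ξ - fourierTransform ρ ξ‖ ^ 2 =
      (∫ x : E, Real.cos (inner ℝ (x : EuclideanSpace ℝ (Fin d)) ξ)
          ∂(empiricalMeasure X : Measure E) -
        ∫ x : E, Real.cos (inner ℝ (x : EuclideanSpace ℝ (Fin d)) ξ) ∂(ρ : Measure E)) ^ 2 +
      (∫ x : E, Real.sin (inner ℝ (x : EuclideanSpace ℝ (Fin d)) ξ)
          ∂(empiricalMeasure X : Measure E) -
        ∫ x : E, Real.sin (inner ℝ (x : EuclideanSpace ℝ (Fin d)) ξ) ∂(ρ : Measure E)) ^ 2 :=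
    fun X => by
      rw [← norm_sq_ofReal_sub_mul_I, fourierTransform_eq_cos_sub_sin,
        fourierTransform_eq_cos_sub_sin]
      push_cast
      ring_nf
  simp only [hpt]
  rw [← ofReal_integral_eq_lintegral_ofReal (by exact i1.add i2)
    (ae_of_all _ fun X => by positivity)]
  refine ENNReal.ofReal_le_ofReal ?_
  rw [integral_add i1 i2]
  refine (add_le_add h1 h2).trans_eq ?_
  rw [← mul_add, ← integral_add j1 j2]
  simp

/-! ### Bounds for the Wasserstein distance -/

theorem integrable_bracket {s : ℝ} (hs : (d : ℝ) / 2 < s) :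
    Integrable fun ξ : EuclideanSpace ℝ (Fin d) => 1 / bracket ξ ^ (2 * s) := by
  have := integrable_rpow_neg_one_add_norm_sq (E := EuclideanSpace ℝ (Fin d)) (μ := volume)
    (r := 2 * s) (by simp; linarith)
  refine this.congr (ae_of_all _ fun ξ => ?_)
  simp only [bracket]
  rw [Real.sqrt_eq_rpow, ← Real.rpow_mul (by positivity), one_div, ← Real.rpow_neg (by positivity)]
  congr 1
  ring

theorem bracket_pos (ξ : EuclideanSpace ℝ (Fin d)) : 0 < bracket ξ :=
  Real.sqrt_pos.2 (by positivity)

theorem measurable_bracket : Measurable (bracket : EuclideanSpace ℝ (Fin d) → ℝ) := by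
  unfold bracket; fun_prop

/-- The left-hand side is `Φ_s(0)`. -/
theorem integral_bracket_le_PhiSupNorm (s : ℝ) :
    ∫ ξ : EuclideanSpace ℝ (Fin d), 1 / bracket ξ ^ (2 * s) ≤ PhiSupNorm d s := by
  refine le_trans ?_ (le_ciSup (bddAbove_norm_Phi d s) 0)
  have : Phi s (0 : EuclideanSpace ℝ (Fin d)) =
      ((∫ ξ : EuclideanSpace ℝ (Fin d), 1 / bracket ξ ^ (2 * s) : ℝ) : ℂ) := by
    rw [← integral_complex_ofReal]
    simp [Phi]
  rw [this, Complex.norm_real]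
  exact le_abs_self _

theorem PhiSupNorm_nonneg (d : ℕ) (s : ℝ) : 0 ≤ PhiSupNorm d s :=
  Real.iSup_nonneg fun _ => norm_nonneg _

theorem measurable_norm_fourierTransform_sub :
    Measurable fun q : (ProbabilityMeasure E × ProbabilityMeasure E) × EuclideanSpace ℝ (Fin d) =>
      ‖fourierTransform q.1.1 q.2 - fourierTransform q.1.2 q.2‖ :=
  ((measurable_fourierTransform.comp (measurable_fst.fst.prodMk measurable_snd)).sub
    (measurable_fourierTransform.comp (measurable_fst.snd.prodMk measurable_snd))).norm

theorem lintegral_sobolevDistSq (s : ℝ) (γ : Measure (ProbabilityMeasure E × ProbabilityMeasure E))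
    [SFinite γ] :
    ∫⁻ p, sobolevDistSq s p.1 p.2 ∂γ = ∫⁻ ξ : EuclideanSpace ℝ (Fin d),
      (∫⁻ p, ENNReal.ofReal (‖fourierTransform p.1 ξ - fourierTransform p.2 ξ‖ ^ 2) ∂γ) *
        ENNReal.ofReal (1 / bracket ξ ^ (2 * s)) := by
  unfold sobolevDistSq
  have h := measurable_norm_fourierTransform_sub (E := E)
  have hb := measurable_bracket (d := d)
  rw [lintegral_lintegral_swap (Measurable.aemeasurable (by
    simp only [Function.uncurry_def]; fun_prop))]
  refine lintegral_congr fun ξ => ?_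
  rw [← lintegral_mul_const _ (by
    exact ((h.comp (measurable_id.prodMk measurable_const)).pow_const 2).ennreal_ofReal)]
  refine lintegral_congr fun p => ?_
  rw [← ENNReal.ofReal_mul (by positivity), mul_one_div]

theorem lintegral_sobolevDistSq_le {s : ℝ} (hs : (d : ℝ) / 2 < s)
    (γ : Measure (ProbabilityMeasure E × ProbabilityMeasure E)) [SFinite γ] {K : ℝ} (hK : 0 ≤ K)
    (h : ∀ ξ, ∫⁻ p, ENNReal.ofReal (‖fourierTransform p.1 ξ - fourierTransform p.2 ξ‖ ^ 2) ∂γ ≤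
      ENNReal.ofReal K) :
    ∫⁻ p, sobolevDistSq s p.1 p.2 ∂γ ≤ ENNReal.ofReal (K * PhiSupNorm d s) := by
  rw [lintegral_sobolevDistSq]
  calc _ ≤ ∫⁻ ξ : EuclideanSpace ℝ (Fin d),
        ENNReal.ofReal K * ENNReal.ofReal (1 / bracket ξ ^ (2 * s)) :=
        lintegral_mono fun ξ => mul_le_mul_left (h ξ) _
    _ = ENNReal.ofReal (K * ∫ ξ : EuclideanSpace ℝ (Fin d), 1 / bracket ξ ^ (2 * s)) := by
        rw [lintegral_const_mul' _ _ ENNReal.ofReal_ne_top, ENNReal.ofReal_mul hK,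
          ofReal_integral_eq_lintegral_ofReal (integrable_bracket hs)
            (ae_of_all _ fun ξ => by have := bracket_pos ξ; positivity)]
    _ ≤ _ := ENNReal.ofReal_le_ofReal
        (mul_le_mul_of_nonneg_left (integral_bracket_le_PhiSupNorm s) hK)

theorem sobolevWasserstein_sq (s : ℝ) (α β : ProbabilityMeasure (ProbabilityMeasure E)) :
    sobolevWasserstein s α β ^ 2 = ⨅ γ ∈ couplings α β, ∫⁻ p, sobolevDistSq s p.1 p.2
      ∂(γ : Measure (ProbabilityMeasure E × ProbabilityMeasure E)) := by
  rw [sobolevWasserstein, ← ENNReal.rpow_natCast, ← ENNReal.rpow_mul]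
  norm_num

theorem sobolevWasserstein_sq_le {s : ℝ} (hs : (d : ℝ) / 2 < s)
    {α β : ProbabilityMeasure (ProbabilityMeasure E)}
    {γ : Measure (ProbabilityMeasure E × ProbabilityMeasure E)} [hγ : IsProbabilityMeasure γ]
    (h1 : γ.map Prod.fst = α) (h2 : γ.map Prod.snd = β) {K : ℝ} (hK : 0 ≤ K)
    (h : ∀ ξ, ∫⁻ p, ENNReal.ofReal (‖fourierTransform p.1 ξ - fourierTransform p.2 ξ‖ ^ 2) ∂γ ≤
      ENNReal.ofReal K) :
    sobolevWasserstein s α β ^ 2 ≤ ENNReal.ofReal (K * PhiSupNorm d s) := by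
  rw [sobolevWasserstein_sq]
  exact (iInf₂_le (⟨γ, hγ⟩ : ProbabilityMeasure _) ⟨h1, h2⟩).trans
    (lintegral_sobolevDistSq_le hs γ hK h)

/-- `ρ ↦ ρ^{⊗j}` as a Markov kernel. -/
noncomputable def tensorKernel (E : Set (EuclideanSpace ℝ (Fin d))) (j : ℕ) :
    Kernel (ProbabilityMeasure E) (Fin j → E) :=
  ⟨tensorPower j, measurable_tensorPower j⟩

instance (j : ℕ) : IsMarkovKernel (tensorKernel E j) :=
  ⟨fun ρ => inferInstanceAs (IsProbabilityMeasure (tensorPower j ρ))⟩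

theorem measurable_ofReal_norm_sub (ξ : EuclideanSpace ℝ (Fin d)) :
    Measurable fun p : ProbabilityMeasure E × ProbabilityMeasure E =>
      ENNReal.ofReal (‖fourierTransform p.1 ξ - fourierTransform p.2 ξ‖ ^ 2) :=
  ((measurable_norm_fourierTransform_sub.comp
    (measurable_id.prodMk measurable_const)).pow_const 2).ennreal_ofReal

/-- The coupling is the law of `(μ_X, ρ)`, where `ρ` has law `α` and `X` has law `ρ^{⊗N}` given
`ρ`. -/
theorem sobolevWasserstein_empiricalLaw_sq_le {s : ℝ} (hs : (d : ℝ) / 2 < s)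
    (α : ProbabilityMeasure (ProbabilityMeasure E)) (N : ℕ) [NeZero N] :
    sobolevWasserstein s (empiricalLaw (mixtureMarginal α N)) α ^ 2 ≤
      ENNReal.ofReal (1 / N * PhiSupNorm d s) := by
  have he := measurable_empiricalMeasure (N := N) (E := E)
  have hp : Measurable fun q : ProbabilityMeasure E × (Fin N → E) =>
      (empiricalMeasure q.2, q.1) := (he.comp measurable_snd).prodMk measurable_fst
  let μ := (α : Measure (ProbabilityMeasure E)) ⊗ₘ tensorKernel E N
  have : IsProbabilityMeasure (μ.map fun q => (empiricalMeasure q.2, q.1)) :=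
    Measure.isProbabilityMeasure_map hp.aemeasurable
  refine sobolevWasserstein_sq_le hs (γ := μ.map fun q => (empiricalMeasure q.2, q.1)) ?_ ?_
    (by positivity) fun ξ => ?_
  · rw [Measure.map_map measurable_fst hp]
    change _ = (Measure.bind (α : Measure (ProbabilityMeasure E)) (tensorKernel E N)).map
      empiricalMeasure
    rw [← Measure.snd_compProd, Measure.snd, Measure.map_map he measurable_snd]
    rfl
  · rw [Measure.map_map measurable_snd hp]
    exact Measure.fst_compProd _ _
  · rw [lintegral_map (measurable_ofReal_norm_sub ξ) hp, Measure.lintegral_compProd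
      (by exact (measurable_ofReal_norm_sub ξ).comp hp)]
    refine (lintegral_mono fun ρ =>
      lintegral_norm_fourierTransform_empiricalMeasure_sub_le (N := N) ρ ξ).trans_eq ?_
    simp

theorem measurable_ofReal_norm_empiricalMeasure_sub {n : ℕ} [NeZero n] (ρ : ProbabilityMeasure E)
    (ξ : EuclideanSpace ℝ (Fin d)) :
    Measurable fun X : Fin n → E => ENNReal.ofReal
      (‖fourierTransform (empiricalMeasure X) ξ - fourierTransform ρ ξ‖ ^ 2) := by
  have h : Measurable fun X : Fin n → E => fourierTransform (empiricalMeasure X) ξ :=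
    measurable_fourierTransform.comp (measurable_empiricalMeasure.prodMk measurable_const)
  exact ((h.sub_const _).norm.pow_const 2).ennreal_ofReal

theorem lintegral_prod_norm_fourierTransform_empiricalMeasure_sub_le (N M : ℕ) [NeZero N]
    [NeZero M] (ρ : ProbabilityMeasure E) (ξ : EuclideanSpace ℝ (Fin d)) :
    ∫⁻ q : (Fin N → E) × (Fin M → E), ENNReal.ofReal (‖fourierTransform
      (empiricalMeasure q.1) ξ - fourierTransform (empiricalMeasure q.2) ξ‖ ^ 2)
      ∂((tensorPower N ρ).prod (tensorPower M ρ)) ≤ ENNReal.ofReal (2 * (1 / N + 1 / M)) := by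
  have hN := measurable_ofReal_norm_empiricalMeasure_sub (n := N) ρ ξ
  have hM := measurable_ofReal_norm_empiricalMeasure_sub (n := M) ρ ξ
  have htri : ∀ a b c : ℂ, ENNReal.ofReal (‖a - b‖ ^ 2) ≤
      2 * (ENNReal.ofReal (‖a - c‖ ^ 2) + ENNReal.ofReal (‖b - c‖ ^ 2)) := fun a b c => by
    rw [← ENNReal.ofReal_add (by positivity) (by positivity),
      show (2 : ℝ≥0∞) = ENNReal.ofReal 2 by simp, ← ENNReal.ofReal_mul (by norm_num)]
    refine ENNReal.ofReal_le_ofReal ?_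
    have h := norm_sub_le (a - c) (b - c)
    rw [sub_sub_sub_cancel_right] at h
    nlinarith [sq_nonneg (‖a - c‖ - ‖b - c‖), norm_nonneg (a - b), norm_nonneg (a - c),
      norm_nonneg (b - c)]
  calc _ ≤ ∫⁻ q : (Fin N → E) × (Fin M → E), 2 * (ENNReal.ofReal
          (‖fourierTransform (empiricalMeasure q.1) ξ - fourierTransform ρ ξ‖ ^ 2) +
        ENNReal.ofReal
          (‖fourierTransform (empiricalMeasure q.2) ξ - fourierTransform ρ ξ‖ ^ 2))
        ∂((tensorPower N ρ).prod (tensorPower M ρ)) := lintegral_mono fun q => htri _ _ _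
    _ = 2 * ((∫⁻ X : Fin N → E, ENNReal.ofReal (‖fourierTransform (empiricalMeasure X) ξ -
            fourierTransform ρ ξ‖ ^ 2) ∂(tensorPower N ρ)) +
          ∫⁻ X : Fin M → E, ENNReal.ofReal (‖fourierTransform (empiricalMeasure X) ξ -
            fourierTransform ρ ξ‖ ^ 2) ∂(tensorPower M ρ)) := by
        rw [lintegral_const_mul' _ _ (by simp),
          lintegral_add_left (by exact hN.comp measurable_fst)]
        congr 2
        · exact measurePreserving_fst.lintegral_comp hN
        · exact measurePreserving_snd.lintegral_comp hM
    _ ≤ 2 * (ENNReal.ofReal (1 / N) + ENNReal.ofReal (1 / M)) := by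
        gcongr <;> exact lintegral_norm_fourierTransform_empiricalMeasure_sub_le ρ ξ
    _ = _ := by
        rw [← ENNReal.ofReal_add (by positivity) (by positivity),
          ENNReal.ofReal_mul (by norm_num)]
        simp

/-- The coupling is the law of `(μ_X, μ_Y)`, where `ρ` has law `α` and, given `ρ`, the samples `X`
and `Y` are independent with laws `ρ^{⊗N}` and `ρ^{⊗M}`. -/
theorem sobolevWasserstein_empiricalLaw_empiricalLaw_sq_le {s : ℝ} (hs : (d : ℝ) / 2 < s)
    (α : ProbabilityMeasure (ProbabilityMeasure E)) (N M : ℕ) [NeZero N] [NeZero M] :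
    sobolevWasserstein s (empiricalLaw (mixtureMarginal α N))
      (empiricalLaw (mixtureMarginal α M)) ^ 2 ≤
      ENNReal.ofReal (2 * (1 / N + 1 / M) * PhiSupNorm d s) := by
  have hN := measurable_empiricalMeasure (N := N) (E := E)
  have hM := measurable_empiricalMeasure (N := M) (E := E)
  have hp : Measurable fun q : ProbabilityMeasure E × ((Fin N → E) × (Fin M → E)) =>
      (empiricalMeasure q.2.1, empiricalMeasure q.2.2) :=
    (hN.comp measurable_snd.fst).prodMk (hM.comp measurable_snd.snd)
  let κ := tensorKernel E N ×ₖ tensorKernel E M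
  let μ := (α : Measure (ProbabilityMeasure E)) ⊗ₘ κ
  have : IsProbabilityMeasure
      (μ.map fun q => (empiricalMeasure q.2.1, empiricalMeasure q.2.2)) :=
    Measure.isProbabilityMeasure_map hp.aemeasurable
  have hsnd : μ.map Prod.snd = κ ∘ₘ (α : Measure (ProbabilityMeasure E)) :=
    Measure.snd_compProd _ _
  refine sobolevWasserstein_sq_le hs
    (γ := μ.map fun q => (empiricalMeasure q.2.1, empiricalMeasure q.2.2)) ?_ ?_
    (by positivity) fun ξ => ?_
  · have h1 : μ.map (fun q => q.2.1) =
        tensorKernel E N ∘ₘ (α : Measure (ProbabilityMeasure E)) := by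
      rw [← Kernel.fst_prod (tensorKernel E N) (tensorKernel E M), Kernel.fst_eq,
        ← Measure.map_comp _ _ measurable_fst]
      change _ = (κ ∘ₘ (α : Measure (ProbabilityMeasure E))).map Prod.fst
      rw [← hsnd, Measure.map_map measurable_fst measurable_snd]
      rfl
    rw [Measure.map_map measurable_fst hp]
    change _ = (tensorKernel E N ∘ₘ (α : Measure (ProbabilityMeasure E))).map empiricalMeasure
    rw [← h1, Measure.map_map hN measurable_snd.fst]
    rfl
  · have h1 : μ.map (fun q => q.2.2) =
        tensorKernel E M ∘ₘ (α : Measure (ProbabilityMeasure E)) := by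
      rw [← Kernel.snd_prod (tensorKernel E N) (tensorKernel E M), Kernel.snd_eq,
        ← Measure.map_comp _ _ measurable_snd]
      change _ = (κ ∘ₘ (α : Measure (ProbabilityMeasure E))).map Prod.snd
      rw [← hsnd, Measure.map_map measurable_snd measurable_snd]
      rfl
    rw [Measure.map_map measurable_snd hp]
    change _ = (tensorKernel E M ∘ₘ (α : Measure (ProbabilityMeasure E))).map empiricalMeasure
    rw [← h1, Measure.map_map hM measurable_snd.snd]
    rfl
  · rw [lintegral_map (measurable_ofReal_norm_sub ξ) hp, Measure.lintegral_compProd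
      (by exact (measurable_ofReal_norm_sub ξ).comp hp)]
    refine (lintegral_mono fun ρ => ?_).trans_eq (lintegral_const (ENNReal.ofReal _) |>.trans (by
      rw [measure_univ, mul_one]))
    have hprod : κ ρ = (tensorPower N ρ).prod (tensorPower M ρ) := Kernel.prod_apply _ _ _
    rw [hprod]
    exact lintegral_prod_norm_fourierTransform_empiricalMeasure_sub_le N M ρ ξ

/-! ### Marginals of a mixture, and how they determine it -/

/-- Moments determine a finite measure on a finite-dimensional cube. A list of indices encodes a
monomial. -/
theorem ext_of_forall_integral_prod_eq {ι : Type*} [Fintype ι] {μ ν : Measure (ι → unitInterval)}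
    [IsFiniteMeasure μ] [IsFiniteMeasure ν]
    (h : ∀ l : List ι, ∫ x, (l.map fun i => (x i : ℝ)).prod ∂μ =
      ∫ x, (l.map fun i => (x i : ℝ)).prod ∂ν) : μ = ν := by
  let coord (i : ι) : (ι → unitInterval) →ᵇ ℝ :=
    BoundedContinuousFunction.mkOfCompact ⟨fun x => (x i : ℝ), by fun_prop⟩
  let A : StarSubalgebra ℝ ((ι → unitInterval) →ᵇ ℝ) :=
    { Algebra.adjoin ℝ (Set.range coord) with
      star_mem' := fun {a} ha => by
        have h : star a = a := by ext; simp
        rwa [h] }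
  refine ext_of_forall_mem_subalgebra_integral_eq_of_polish (𝕜 := ℝ) (A := A) ?_ fun g hg => ?_
  · intro x y hxy
    obtain ⟨i, hi⟩ := Function.ne_iff.1 hxy
    exact ⟨coord i, ⟨_, ⟨coord i, Algebra.subset_adjoin ⟨i, rfl⟩, rfl⟩, rfl⟩,
      fun h => hi (Subtype.ext h)⟩
  · change g ∈ Subalgebra.toSubmodule (Algebra.adjoin ℝ (Set.range coord)) at hg
    rw [Algebra.adjoin_eq_span] at hg
    induction hg using Submodule.span_induction with
    | mem g hg =>
      obtain ⟨l, hl⟩ : ∃ l : List ι, ∀ x, g x = (l.map fun i => (x i : ℝ)).prod := by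
        induction hg using Submonoid.closure_induction with
        | mem _ hg => obtain ⟨i, rfl⟩ := hg; exact ⟨[i], fun x => by simp [coord]⟩
        | one => exact ⟨[], fun x => by simp⟩
        | mul f g _ _ hf hg =>
          obtain ⟨l, hl⟩ := hf
          obtain ⟨m, hm⟩ := hg
          exact ⟨l ++ m, fun x => by simp [hl, hm]⟩
      simp only [hl, h]
    | zero => simp
    | add f g _ _ hf hg =>
      simp only [BoundedContinuousFunction.coe_add, Pi.add_apply]
      rw [integral_add (f.integrable μ) (g.integrable μ),
        integral_add (f.integrable ν) (g.integrable ν), hf, hg]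
    | smul c g _ hg =>
      simp only [BoundedContinuousFunction.coe_smul]
      rw [integral_smul, integral_smul, hg]

theorem integral_mixtureMarginal (α : ProbabilityMeasure (ProbabilityMeasure E)) {j : ℕ}
    {F : Type*} [NormedAddCommGroup F] [NormedSpace ℝ F] {f : (Fin j → E) → F}
    (hf : Integrable f (mixtureMarginal α j : Measure (Fin j → E))) :
    ∫ X, f X ∂(mixtureMarginal α j : Measure (Fin j → E)) =
      ∫ ρ, ∫ X, f X ∂(tensorPower j ρ) ∂(α : Measure (ProbabilityMeasure E)) := by
  have hsnd : (mixtureMarginal α j : Measure (Fin j → E)) =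
      ((α : Measure (ProbabilityMeasure E)) ⊗ₘ tensorKernel E j).map Prod.snd :=
    (Measure.snd_compProd _ (tensorKernel E j)).symm
  rw [hsnd] at hf ⊢
  rw [integral_map measurable_snd.aemeasurable hf.aestronglyMeasurable]
  exact Measure.integral_compProd (hf.comp_measurable measurable_snd)

/-- The values of the marginals at boxes `A₁ × … × A_j` are the mixed moments of the evaluations
`ρ ↦ ρ(A)`, and these evaluations generate the σ-algebra of `P(E)`. -/
theorem eq_of_mixtureMarginal_eq {α β : ProbabilityMeasure (ProbabilityMeasure E)}
    (h : ∀ j : ℕ+, mixtureMarginal α j = mixtureMarginal β j) : α = β := by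
  let I := {A : Set E // MeasurableSet A}
  let T : ProbabilityMeasure E → I → unitInterval := fun ρ A =>
    ⟨(ρ : Measure E).real A, measureReal_nonneg, measureReal_le_one⟩
  have hev : ∀ A : I, Measurable fun ρ : ProbabilityMeasure E => (ρ : Measure E) A := fun A =>
    (Measure.measurable_coe A.2).comp measurable_subtype_coe
  have hT : Measurable T := measurable_pi_iff.2 fun A => ((hev A).ennreal_toReal).subtype_mk
  -- the σ-algebra of `P(E)` is generated by the evaluations
  have hcomap : (inferInstance : MeasurableSpace (ProbabilityMeasure E)) ≤
      MeasurableSpace.comap T inferInstance := by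
    have : @Measurable _ _ (MeasurableSpace.comap T inferInstance) inferInstance
        (id : ProbabilityMeasure E → ProbabilityMeasure E) := by
      let _ : MeasurableSpace (ProbabilityMeasure E) := MeasurableSpace.comap T inferInstance
      refine Measurable.subtype_mk (Measure.measurable_of_measurable_coe _ fun A hA => ?_)
      have hTA : Measurable fun ρ => ENNReal.ofReal (T ρ ⟨A, hA⟩) :=
        ((measurable_pi_apply (⟨A, hA⟩ : I)).comp
          (comap_measurable T)).subtype_val.ennreal_ofReal
      convert hTA with ρ
      exact (ENNReal.ofReal_toReal (measure_ne_top (ρ : Measure E) A)).symm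
    intro S hS
    exact this hS
  have hmom : ∀ l : List I,
      ∫ ρ : ProbabilityMeasure E, (l.map fun A => (T ρ A : ℝ)).prod
        ∂(α : Measure (ProbabilityMeasure E)) =
      ∫ ρ : ProbabilityMeasure E, (l.map fun A => (T ρ A : ℝ)).prod
        ∂(β : Measure (ProbabilityMeasure E)) := by
    intro l
    rcases l.eq_nil_or_concat with rfl | hl
    · simp
    have hpos : 0 < l.length := by
      obtain ⟨l', a, rfl⟩ := hl
      simp
    have hgen : ∀ δ : ProbabilityMeasure (ProbabilityMeasure E),
        ∫ ρ : ProbabilityMeasure E, (l.map fun A => (T ρ A : ℝ)).prod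
          ∂(δ : Measure (ProbabilityMeasure E)) =
        ((mixtureMarginal δ l.length : Measure (Fin l.length → E))
          (Set.univ.pi fun i => (l[i.1] : Set E))).toReal := fun δ => by
      have hm : Measurable fun ρ : ProbabilityMeasure E =>
          ∏ i : Fin l.length, (ρ : Measure E) (l[i.1] : Set E) :=
        Finset.measurable_prod _ fun i _ => hev _
      rw [mixtureMarginal_univ_pi δ fun i => l[i.1].2, ← integral_toReal hm.aemeasurable
        (ae_of_all _ fun ρ => ENNReal.prod_lt_top fun i _ => measure_lt_top _ _)]
      refine integral_congr_ae (ae_of_all _ fun ρ => ?_)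
      simp only [← Fin.prod_univ_fun_getElem, ENNReal.toReal_prod]
      rfl
    rw [hgen, hgen, show mixtureMarginal α l.length = mixtureMarginal β l.length from
      h ⟨l.length, hpos⟩]
  have hpα : IsProbabilityMeasure ((α : Measure (ProbabilityMeasure E)).map T) :=
    Measure.isProbabilityMeasure_map hT.aemeasurable
  have hpβ : IsProbabilityMeasure ((β : Measure (ProbabilityMeasure E)).map T) :=
    Measure.isProbabilityMeasure_map hT.aemeasurable
  have hmap : (α : Measure (ProbabilityMeasure E)).map T =
      (β : Measure (ProbabilityMeasure E)).map T := by
    refine IsProjectiveLimit.unique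
      (P := fun J => ((β : Measure (ProbabilityMeasure E)).map T).map J.restrict)
      (fun J => ?_) fun J => rfl
    refine ext_of_forall_integral_prod_eq fun l => ?_
    have hJ : Measurable (J.restrict ∘ T) := (Finset.measurable_restrict J).comp hT
    have hf : Continuous fun x : J → unitInterval => (l.map fun i => (x i : ℝ)).prod :=
      continuous_list_prod _ fun i _ => by fun_prop
    dsimp only
    rw [Measure.map_map (Finset.measurable_restrict J) hT,
      Measure.map_map (Finset.measurable_restrict J) hT,
      integral_map hJ.aemeasurable hf.aestronglyMeasurable,
      integral_map hJ.aemeasurable hf.aestronglyMeasurable]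
    have := hmom (l.map Subtype.val)
    simp only [List.map_map, Function.comp_def] at this
    exact this
  refine Subtype.ext (Measure.ext fun S hS => ?_)
  obtain ⟨S', hS', rfl⟩ := hcomap S hS
  have := congrArg (fun m => m S') hmap
  simp only [Measure.map_apply hT hS'] at this
  exact this

/-- Symmetry is the case of a permutation `e`, compatibility that of the inclusion of the first `l`
indices. -/
theorem mixtureMarginal_map_comp (α : ProbabilityMeasure (ProbabilityMeasure E)) {l j : ℕ}
    {e : Fin l → Fin j} (he : Function.Injective e) :
    (mixtureMarginal α j : Measure (Fin j → E)).map (fun X i => X (e i)) =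
      (mixtureMarginal α l : Measure (Fin l → E)) := by
  have hm : Measurable fun (X : Fin j → E) i => X (e i) := by fun_prop
  have hκ : (tensorKernel E j).map (fun X i => X (e i)) = tensorKernel E l := by
    ext1 ρ
    rw [Kernel.map_apply _ hm]
    have hind : iIndepFun (fun (k : Fin j) (X : Fin j → E) => X k) (tensorPower j ρ) :=
      iIndepFun_pi (μ := fun _ => (ρ : Measure E)) (X := fun _ => id)
        fun _ => aemeasurable_id
    have := (iIndepFun_iff_map_fun_eq_pi_map (fun i => (measurable_pi_apply _).aemeasurable)).1
      (hind.precomp he)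
    refine this.trans ?_
    change _ = Measure.pi fun _ => (ρ : Measure E)
    congr 1
    ext1 i
    exact (measurePreserving_eval (fun _ : Fin j => (ρ : Measure E)) (e i)).map_eq
  change (tensorKernel E j ∘ₘ (α : Measure (ProbabilityMeasure E))).map _ =
    tensorKernel E l ∘ₘ (α : Measure (ProbabilityMeasure E))
  rw [Measure.map_comp _ _ hm, hκ]

/-! ### Uniqueness of Wasserstein limits -/

/-- A law on `E^j` is determined by its characteristic function, being the restriction of a law on
`(ℝ^d)^j`. Measurability of `E` makes the inclusion a measurable embedding. -/
theorem measure_eq_of_integral_prod_exp_eq (hE : MeasurableSet E) {j : ℕ}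
    {μ ν : Measure (Fin j → E)} [IsProbabilityMeasure μ] [IsProbabilityMeasure ν]
    (h : ∀ t : Fin j → EuclideanSpace ℝ (Fin d),
      ∫ X, ∏ i, Complex.exp (-(Complex.I *
        (inner ℝ (X i : EuclideanSpace ℝ (Fin d)) (t i) : ℝ))) ∂μ =
      ∫ X, ∏ i, Complex.exp (-(Complex.I *
        (inner ℝ (X i : EuclideanSpace ℝ (Fin d)) (t i) : ℝ))) ∂ν) : μ = ν := by
  have : StandardBorelSpace E := hE.standardBorel
  let ι : (Fin j → E) → Fin j → EuclideanSpace ℝ (Fin d) := fun X i => X i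
  have hι : Measurable ι := by fun_prop
  have hemb : MeasurableEmbedding ι := hι.measurableEmbedding fun X Y hXY =>
    funext fun i => Subtype.ext (congrFun hXY i)
  refine hemb.map_injective (Measure.ext_of_charFunDual (funext fun L => ?_))
  let t : Fin j → EuclideanSpace ℝ (Fin d) := fun i => -(InnerProductSpace.toDual ℝ _).symm
    (L.comp (ContinuousLinearMap.single ℝ (fun _ => EuclideanSpace ℝ (Fin d)) i))
  have hL : ∀ X : Fin j → E, Complex.exp (L (ι X) * Complex.I) =
      ∏ i, Complex.exp (-(Complex.I *
        (inner ℝ (X i : EuclideanSpace ℝ (Fin d)) (t i) : ℝ))) := fun X => by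
    rw [← Complex.exp_sum, ← L.sum_comp_single]
    congr 1
    push_cast
    rw [Finset.sum_mul]
    refine Finset.sum_congr rfl fun i _ => ?_
    have : inner ℝ (X i : EuclideanSpace ℝ (Fin d)) (t i) =
        -(L.comp (ContinuousLinearMap.single ℝ (fun _ => EuclideanSpace ℝ (Fin d)) i)) (X i) := by
      rw [real_inner_comm]
      simp only [t, inner_neg_left, InnerProductSpace.toDual_symm_apply]
    rw [this]
    push_cast
    simp only [ι]
    ring
  rw [charFunDual_apply, charFunDual_apply, integral_map hι.aemeasurable
    (Continuous.aestronglyMeasurable (by fun_prop)), integral_map hι.aemeasurable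
    (Continuous.aestronglyMeasurable (by fun_prop))]
  simp only [hL, h t]

/-- `t ↦ ∫ ∏ ρ̂(t_i) α(dρ)`, the characteristic function of the marginal `α_j`. -/
noncomputable def mixtureTransform (α : ProbabilityMeasure (ProbabilityMeasure E)) {j : ℕ}
    (t : Fin j → EuclideanSpace ℝ (Fin d)) : ℂ :=
  ∫ ρ, ∏ i, fourierTransform ρ (t i) ∂(α : Measure (ProbabilityMeasure E))

theorem integral_mixtureMarginal_prod_exp (α : ProbabilityMeasure (ProbabilityMeasure E)) {j : ℕ}
    (t : Fin j → EuclideanSpace ℝ (Fin d)) :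
    ∫ X, ∏ i, Complex.exp (-(Complex.I *
        (inner ℝ (X i : EuclideanSpace ℝ (Fin d)) (t i) : ℝ)))
      ∂(mixtureMarginal α j : Measure (Fin j → E)) = mixtureTransform α t := by
  rw [integral_mixtureMarginal]
  · refine integral_congr_ae (ae_of_all _ fun ρ => ?_)
    exact integral_fintype_prod_eq_prod (μ := fun _ : Fin j => (ρ : Measure E))
      fun i (x : E) => Complex.exp (-(Complex.I *
        (inner ℝ (x : EuclideanSpace ℝ (Fin d)) (t i) : ℝ)))
  · refine Integrable.of_bound (Measurable.aestronglyMeasurable (by fun_prop)) 1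
      (ae_of_all _ fun X => ?_)
    simp [Complex.norm_exp]

theorem measurable_fourierTransform_left (ξ : EuclideanSpace ℝ (Fin d)) :
    Measurable fun ρ : ProbabilityMeasure E => fourierTransform ρ ξ :=
  measurable_fourierTransform.comp (measurable_id.prodMk measurable_const)

theorem norm_prod_fourierTransform_le_one (ρ : ProbabilityMeasure E) {j : ℕ}
    (t : Fin j → EuclideanSpace ℝ (Fin d)) : ‖∏ i, fourierTransform ρ (t i)‖ ≤ 1 := by
  rw [norm_prod]
  exact Finset.prod_le_one (fun i _ => norm_nonneg _) fun i _ => norm_fourierTransform_le_one ρ _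

theorem continuous_mixtureTransform (α : ProbabilityMeasure (ProbabilityMeasure E)) {j : ℕ} :
    Continuous (mixtureTransform α : (Fin j → EuclideanSpace ℝ (Fin d)) → ℂ) := by
  refine continuous_of_dominated (bound := fun _ => 1) (fun t => ?_)
    (fun t => ae_of_all _ fun ρ => norm_prod_fourierTransform_le_one ρ t) (integrable_const _)
    (ae_of_all _ fun ρ => ?_)
  · exact (Finset.measurable_prod _ fun i _ =>
      measurable_fourierTransform_left (t i)).aestronglyMeasurable
  · exact continuous_finsetProd _ fun i _ =>
      (continuous_fourierTransform ρ).comp (continuous_apply i)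

theorem norm_prod_sub_prod_le {ι : Type*} (s : Finset ι) {a b : ι → ℂ} (ha : ∀ i, ‖a i‖ ≤ 1)
    (hb : ∀ i, ‖b i‖ ≤ 1) : ‖∏ i ∈ s, a i - ∏ i ∈ s, b i‖ ≤ ∑ i ∈ s, ‖a i - b i‖ := by
  classical
  induction s using Finset.induction_on with
  | empty => simp
  | insert k s hk ih =>
    rw [Finset.prod_insert hk, Finset.prod_insert hk, Finset.sum_insert hk]
    have h1 : ‖∏ i ∈ s, a i‖ ≤ 1 := by
      rw [norm_prod]; exact Finset.prod_le_one (fun i _ => norm_nonneg _) fun i _ => ha i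
    calc _ = ‖(a k - b k) * ∏ i ∈ s, a i + b k * (∏ i ∈ s, a i - ∏ i ∈ s, b i)‖ := by ring_nf
      _ ≤ ‖a k - b k‖ * ‖∏ i ∈ s, a i‖ + ‖b k‖ * ‖∏ i ∈ s, a i - ∏ i ∈ s, b i‖ := by
        rw [← norm_mul, ← norm_mul]; exact norm_add_le _ _
      _ ≤ ‖a k - b k‖ * 1 + 1 * ∑ i ∈ s, ‖a i - b i‖ := by
        gcongr
        exact hb k
      _ = _ := by ring

theorem lintegral_sq_le_lintegral_sq {Ω : Type*} [MeasurableSpace Ω] {μ : Measure Ω}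
    [IsProbabilityMeasure μ] {f : Ω → ℝ≥0∞} (hf : AEMeasurable f μ) :
    (∫⁻ x, f x ∂μ) ^ 2 ≤ ∫⁻ x, f x ^ 2 ∂μ := by
  have h := ENNReal.lintegral_mul_le_Lp_mul_Lq μ Real.HolderConjugate.two_two hf
    (aemeasurable_const (b := (1 : ℝ≥0∞)))
  simp only [Pi.mul_apply, mul_one, ENNReal.one_rpow, lintegral_const, measure_univ] at h
  calc _ ≤ ((∫⁻ x, f x ^ (2 : ℝ) ∂μ) ^ (1 / 2 : ℝ)) ^ 2 := by gcongr
    _ = _ := by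
      rw [← ENNReal.rpow_natCast, ← ENNReal.rpow_mul]
      norm_num

/-- Transforms have modulus at most one, so the difference of two products is bounded by the sum of
the differences of the factors, and each of these by its `L²` norm under the coupling. -/
theorem enorm_mixtureTransform_sub_le {α β : ProbabilityMeasure (ProbabilityMeasure E)}
    {γ : ProbabilityMeasure (ProbabilityMeasure E × ProbabilityMeasure E)}
    (hγ : γ ∈ couplings α β) {j : ℕ} (t : Fin j → EuclideanSpace ℝ (Fin d)) :
    ‖mixtureTransform α t - mixtureTransform β t‖ₑ ≤
      ∑ i, (∫⁻ p, ENNReal.ofReal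
        (‖fourierTransform p.1 (t i) - fourierTransform p.2 (t i)‖ ^ 2)
        ∂(γ : Measure (ProbabilityMeasure E × ProbabilityMeasure E))) ^ (1 / 2 : ℝ) := by
  have hm : Measurable fun ρ : ProbabilityMeasure E => ∏ i, fourierTransform ρ (t i) :=
    Finset.measurable_prod _ fun i _ => measurable_fourierTransform_left (t i)
  have hint : ∀ f : ProbabilityMeasure E × ProbabilityMeasure E → ProbabilityMeasure E,
      Measurable f → Integrable (fun p => ∏ i, fourierTransform (f p) (t i))
        (γ : Measure (ProbabilityMeasure E × ProbabilityMeasure E)) := fun f hf =>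
    Integrable.of_bound (hm.comp hf).aestronglyMeasurable 1
      (ae_of_all _ fun p => norm_prod_fourierTransform_le_one _ t)
  have hd : ∀ i, Measurable fun p : ProbabilityMeasure E × ProbabilityMeasure E =>
      ‖fourierTransform p.1 (t i) - fourierTransform p.2 (t i)‖ₑ := fun i =>
    (((measurable_fourierTransform_left (t i)).comp measurable_fst).sub
      ((measurable_fourierTransform_left (t i)).comp measurable_snd)).enorm
  have hsub : mixtureTransform α t - mixtureTransform β t =
      ∫ p, (∏ i, fourierTransform p.1 (t i) - ∏ i, fourierTransform p.2 (t i))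
        ∂(γ : Measure (ProbabilityMeasure E × ProbabilityMeasure E)) := by
    rw [integral_sub (hint _ measurable_fst) (hint _ measurable_snd), mixtureTransform,
      mixtureTransform, ← hγ.1, ← hγ.2,
      integral_map measurable_fst.aemeasurable hm.aestronglyMeasurable,
      integral_map measurable_snd.aemeasurable hm.aestronglyMeasurable]
  rw [hsub]
  calc _ ≤ ∫⁻ p, ‖∏ i, fourierTransform p.1 (t i) - ∏ i, fourierTransform p.2 (t i)‖ₑ
        ∂(γ : Measure (ProbabilityMeasure E × ProbabilityMeasure E)) :=
        enorm_integral_le_lintegral_enorm _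
    _ ≤ ∫⁻ p, ∑ i, ‖fourierTransform p.1 (t i) - fourierTransform p.2 (t i)‖ₑ
        ∂(γ : Measure (ProbabilityMeasure E × ProbabilityMeasure E)) := by
        refine lintegral_mono fun p => ?_
        simp only [← ofReal_norm]
        rw [← ENNReal.ofReal_sum_of_nonneg fun i _ => norm_nonneg _]
        exact ENNReal.ofReal_le_ofReal (norm_prod_sub_prod_le _
          (fun i => norm_fourierTransform_le_one _ _) fun i => norm_fourierTransform_le_one _ _)
    _ = ∑ i, ∫⁻ p, ‖fourierTransform p.1 (t i) - fourierTransform p.2 (t i)‖ₑ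
        ∂(γ : Measure (ProbabilityMeasure E × ProbabilityMeasure E)) :=
        lintegral_finsetSum _ fun i _ => hd i
    _ ≤ _ := by
        refine Finset.sum_le_sum fun i _ => ?_
        have := lintegral_sq_le_lintegral_sq
          (μ := (γ : Measure (ProbabilityMeasure E × ProbabilityMeasure E))) (hd i).aemeasurable
        rw [← ENNReal.rpow_le_rpow_iff (z := 2) (by norm_num), ← ENNReal.rpow_mul]
        norm_num
        refine this.trans_eq (lintegral_congr fun p => ?_)
        rw [← ofReal_norm]

/-- The costs are summable, so for almost every `ξ` the mean square differences at `ξ` are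
summable in `m`. -/
theorem ae_tendsto_lintegral_norm_fourierTransform_sub {s : ℝ}
    {γ : ℕ → ProbabilityMeasure (ProbabilityMeasure E × ProbabilityMeasure E)}
    (h : ∀ m, ∫⁻ p, sobolevDistSq s p.1 p.2
      ∂(γ m : Measure (ProbabilityMeasure E × ProbabilityMeasure E)) ≤ 2⁻¹ ^ m) :
    ∀ᵐ ξ : EuclideanSpace ℝ (Fin d), Tendsto (fun m => ∫⁻ p, ENNReal.ofReal
      (‖fourierTransform p.1 ξ - fourierTransform p.2 ξ‖ ^ 2)
      ∂(γ m : Measure (ProbabilityMeasure E × ProbabilityMeasure E))) atTop (𝓝 0) := by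
  let H (m : ℕ) (ξ : EuclideanSpace ℝ (Fin d)) : ℝ≥0∞ := ∫⁻ p, ENNReal.ofReal
      (‖fourierTransform p.1 ξ - fourierTransform p.2 ξ‖ ^ 2)
      ∂(γ m : Measure (ProbabilityMeasure E × ProbabilityMeasure E))
  have hH : ∀ m, Measurable (H m) := fun m =>
    Measurable.lintegral_prod_left'
      (f := fun q : (ProbabilityMeasure E × ProbabilityMeasure E) × EuclideanSpace ℝ (Fin d) =>
        ENNReal.ofReal (‖fourierTransform q.1.1 q.2 - fourierTransform q.1.2 q.2‖ ^ 2))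
      ((measurable_norm_fourierTransform_sub.pow_const 2).ennreal_ofReal)
  have hw : Measurable fun ξ : EuclideanSpace ℝ (Fin d) =>
      ENNReal.ofReal (1 / bracket ξ ^ (2 * s)) := by
    have := measurable_bracket (d := d)
    fun_prop
  have hsum : ∫⁻ ξ, ∑' m, H m ξ * ENNReal.ofReal (1 / bracket ξ ^ (2 * s)) ≠ ∞ := by
    rw [lintegral_tsum fun m => by exact ((hH m).mul hw).aemeasurable]
    refine ne_top_of_le_ne_top (b := 2) (by simp) ?_
    refine le_trans ?_ ENNReal.tsum_geometric_two.le
    exact ENNReal.tsum_le_tsum fun m => (lintegral_sobolevDistSq s _).symm.trans_le (h m)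
  have hmeas : Measurable fun ξ => ∑' m, H m ξ * ENNReal.ofReal (1 / bracket ξ ^ (2 * s)) :=
    Measurable.tsum fun m => (hH m).mul hw
  filter_upwards [ae_lt_top hmeas hsum] with ξ hξ
  have hw0 : ENNReal.ofReal (1 / bracket ξ ^ (2 * s)) ≠ 0 := by
    have := Real.rpow_pos_of_pos (bracket_pos ξ) (2 * s)
    simpa using this
  have := ENNReal.tendsto_atTop_zero_of_tsum_ne_top hξ.ne
  have h2 := ENNReal.Tendsto.mul_const (b := (ENNReal.ofReal (1 / bracket ξ ^ (2 * s)))⁻¹) this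
    (Or.inr (ENNReal.inv_ne_top.2 hw0))
  simp only [zero_mul] at h2
  refine h2.congr fun m => ?_
  rw [mul_assoc, ENNReal.mul_inv_cancel hw0 ENNReal.ofReal_ne_top, mul_one]

/-- Two limits of one sequence have the same marginals: their transforms agree at all tuples of
frequencies taken from a set of full measure, hence everywhere by continuity. -/
theorem mixtureMarginal_eq_of_tendsto (hE : MeasurableSet E) {s : ℝ}
    {μ : ℕ+ → ProbabilityMeasure (ProbabilityMeasure E)}
    {α β : ProbabilityMeasure (ProbabilityMeasure E)}
    (hα : Tendsto (fun n => sobolevWasserstein s (μ n) α) atTop (𝓝 0))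
    (hβ : Tendsto (fun n => sobolevWasserstein s (μ n) β) atTop (𝓝 0)) (j : ℕ) :
    mixtureMarginal α j = mixtureMarginal β j := by
  have hex : ∀ m : ℕ, ∃ n : ℕ+, (∃ γ ∈ couplings (μ n) α, ∫⁻ p, sobolevDistSq s p.1 p.2
        ∂(γ : Measure (ProbabilityMeasure E × ProbabilityMeasure E)) ≤ 2⁻¹ ^ m) ∧
      ∃ γ ∈ couplings (μ n) β, ∫⁻ p, sobolevDistSq s p.1 p.2
        ∂(γ : Measure (ProbabilityMeasure E × ProbabilityMeasure E)) ≤ 2⁻¹ ^ m := by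
    intro m
    have hpos : (0 : ℝ≥0∞) < 2⁻¹ ^ m := ENNReal.pow_pos (by simp) m
    have hsq : ∀ {δ : ProbabilityMeasure (ProbabilityMeasure E)},
        Tendsto (fun n => sobolevWasserstein s (μ n) δ) atTop (𝓝 0) →
        ∀ᶠ n in atTop, ∃ γ ∈ couplings (μ n) δ, ∫⁻ p, sobolevDistSq s p.1 p.2
          ∂(γ : Measure (ProbabilityMeasure E × ProbabilityMeasure E)) ≤ 2⁻¹ ^ m := by
      intro δ hδ
      have h2 : Tendsto (fun n => sobolevWasserstein s (μ n) δ ^ 2) atTop (𝓝 0) := by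
        simpa using ENNReal.Tendsto.pow (n := 2) hδ
      filter_upwards [h2.eventually (gt_mem_nhds hpos)] with n hn
      rw [sobolevWasserstein_sq] at hn
      simp only [iInf_lt_iff] at hn
      obtain ⟨γ, hγ, h⟩ := hn
      exact ⟨γ, hγ, h.le⟩
    exact ((hsq hα).and (hsq hβ)).exists
  choose n h1 h2 using hex
  choose γ hγ hγm using h1
  choose γ' hγ' hγm' using h2
  have hae := (ae_tendsto_lintegral_norm_fourierTransform_sub hγm).and
    (ae_tendsto_lintegral_norm_fourierTransform_sub hγm')
  have hdense := Measure.dense_of_ae hae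
  have heq : (mixtureTransform α : (Fin j → EuclideanSpace ℝ (Fin d)) → ℂ) =
      mixtureTransform β := by
    refine Continuous.ext_on (dense_pi Set.univ fun _ _ => hdense)
      (continuous_mixtureTransform α) (continuous_mixtureTransform β) fun t ht => ?_
    have ht1 : ∀ i, _ := fun i => (ht i trivial).1
    have ht2 : ∀ i, _ := fun i => (ht i trivial).2
    have hlim : ∀ {g : Fin j → ℕ → ℝ≥0∞}, (∀ i, Tendsto (g i) atTop (𝓝 0)) →
        Tendsto (fun m => ∑ i, g i m ^ (1 / 2 : ℝ)) atTop (𝓝 0) := fun {g} hg => by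
      have := tendsto_finsetSum (Finset.univ : Finset (Fin j)) fun i _ =>
        (hg i).ennrpow_const (1 / 2 : ℝ)
      simpa using this
    have hbound := (hlim ht1).add (hlim ht2)
    rw [add_zero] at hbound
    have hle : ‖mixtureTransform α t - mixtureTransform β t‖ₑ ≤ 0 := by
      refine ge_of_tendsto' hbound fun m => ?_
      refine le_trans ?_ (add_le_add (enorm_mixtureTransform_sub_le (hγ m) t)
        (enorm_mixtureTransform_sub_le (hγ' m) t))
      rw [← enorm_neg (mixtureTransform (μ (n m)) t - mixtureTransform α t)]
      refine le_trans (le_of_eq ?_) (enorm_add_le _ _)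
      congr 1
      ring
    exact sub_eq_zero.1 (enorm_eq_zero.1 (nonpos_iff_eq_zero.1 hle))
  refine Subtype.ext (measure_eq_of_integral_prod_exp_eq hE
    (μ := (mixtureMarginal α j : Measure (Fin j → E)))
    (ν := (mixtureMarginal β j : Measure (Fin j → E))) fun t => ?_)
  rw [integral_mixtureMarginal_prod_exp, integral_mixtureMarginal_prod_exp, heq]

/-! ### Test functions and the rate -/

theorem integral_boundedContinuous_mixtureMarginal
    (α : ProbabilityMeasure (ProbabilityMeasure E)) {j : ℕ} (φ : (Fin j → E) →ᵇ ℝ) :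
    ∫ X, φ X ∂(mixtureMarginal α j : Measure (Fin j → E)) =
      ∫ ρ, monomialFun φ ρ ∂(α : Measure (ProbabilityMeasure E)) :=
  integral_mixtureMarginal α (φ.integrable _)

theorem eq_mixtureMarginal_of_forall_integral_eq {α : ProbabilityMeasure (ProbabilityMeasure E)}
    {j : ℕ} {G : ProbabilityMeasure (Fin j → E)}
    (h : ∀ φ : (Fin j → E) →ᵇ ℝ, ∫ X, φ X ∂(G : Measure (Fin j → E)) =
      ∫ ρ, monomialFun φ ρ ∂(α : Measure (ProbabilityMeasure E))) : G = mixtureMarginal α j :=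
  Subtype.ext (ext_of_forall_integral_eq_of_IsFiniteMeasure (μ := (G : Measure (Fin j → E)))
    (ν := (mixtureMarginal α j : Measure (Fin j → E)))
    fun φ => (h φ).trans (integral_boundedContinuous_mixtureMarginal α φ).symm)

theorem tendsto_ofReal_div_sqrt (c : ℝ) :
    Tendsto (fun j : ℕ+ => ENNReal.ofReal (c / √(j : ℝ))) atTop (𝓝 0) := by
  have h : Tendsto (fun j : ℕ+ => ((j : ℕ) : ℝ)) atTop atTop :=
    tendsto_natCast_atTop_atTop.comp tendsto_PNat_val_atTop_atTop
  have := ENNReal.tendsto_ofReal ((Real.tendsto_sqrt_atTop.comp h).const_div_atTop c)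
  simpa using this

end DeFinetti

open DeFinetti

theorem mainTheorem9 (d : ℕ) (s : ℝ) (hs : (d : ℝ) / 2 < s) :
    ∃ C : ℝ, ∀ E : Set (EuclideanSpace ℝ (Fin d)), MeasurableSet E →
      (∀ π : (j : ℕ+) → ProbabilityMeasure (Fin j → E),
        (∀ j, IsSymmetric (π j)) → IsCompatible π →
          -- quantitative estimate
          (∀ N M : ℕ+, sobolevWasserstein s (empiricalLaw (π N)) (empiricalLaw (π M)) ^ 2 ≤
            ENNReal.ofReal (2 * PhiSupNorm d s * (1 / (M : ℝ) + 1 / (N : ℝ)))) ∧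
          -- Cauchy property
          (∀ ε : ℝ≥0∞, 0 < ε → ∃ N₀ : ℕ+, ∀ N M : ℕ+, N₀ ≤ N → N₀ ≤ M →
            sobolevWasserstein s (empiricalLaw (π N)) (empiricalLaw (π M)) < ε) ∧
          -- limit, with rate, and its characterization
          ∃ α : ProbabilityMeasure (ProbabilityMeasure E),
            Tendsto (fun j => sobolevWasserstein s (empiricalLaw (π j)) α) atTop (𝓝 0) ∧
            (∀ j : ℕ+, sobolevWasserstein s (empiricalLaw (π j)) α ≤
              ENNReal.ofReal (C / √(j : ℝ))) ∧
            (∀ j : ℕ+, π j = mixtureMarginal α j) ∧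
            (∀ (j : ℕ+) (φ : (Fin j → E) →ᵇ ℝ),
              ∫ X, φ X ∂(π j : Measure (Fin j → E)) =
                ∫ ρ, monomialFun φ ρ ∂(α : Measure (ProbabilityMeasure E))) ∧
            (∀ β : ProbabilityMeasure (ProbabilityMeasure E),
              Tendsto (fun j => sobolevWasserstein s (empiricalLaw (π j)) β) atTop (𝓝 0) →
                β = α) ∧
            (∀ β : ProbabilityMeasure (ProbabilityMeasure E),
              (∀ j : ℕ+, π j = mixtureMarginal β j) → β = α) ∧
            (∀ β : ProbabilityMeasure (ProbabilityMeasure E),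
              (∀ (j : ℕ+) (φ : (Fin j → E) →ᵇ ℝ),
                ∫ X, φ X ∂(π j : Measure (Fin j → E)) =
                  ∫ ρ, monomialFun φ ρ ∂(β : Measure (ProbabilityMeasure E))) → β = α)) ∧
      -- converse
      (∀ α : ProbabilityMeasure (ProbabilityMeasure E),
        (∀ j : ℕ+, IsSymmetric (mixtureMarginal α j)) ∧
          IsCompatible (fun j : ℕ+ => mixtureMarginal α j)) := by
  refine ⟨√(PhiSupNorm d s), fun E hE => ⟨fun π hsym hcomp => ?_, fun α => ⟨fun j σ =>
    mixtureMarginal_map_comp α σ.injective, fun l j h =>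
    mixtureMarginal_map_comp α (Fin.castLE_injective h)⟩⟩⟩
  obtain ⟨α, hα⟩ := exists_eq_mixtureMarginal hE hsym hcomp
  have hΦ := PhiSupNorm_nonneg d s
  have hrate : ∀ {β : ProbabilityMeasure (ProbabilityMeasure E)},
      (∀ j : ℕ+, π j = mixtureMarginal β j) → ∀ j : ℕ+,
      sobolevWasserstein s (empiricalLaw (π j)) β ≤
        ENNReal.ofReal (√(PhiSupNorm d s) / √(j : ℝ)) := fun {β} hβ j => by
    rw [← ENNReal.pow_le_pow_left_iff two_ne_zero, ← ENNReal.ofReal_pow (by positivity), div_pow,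
      Real.sq_sqrt hΦ, Real.sq_sqrt (by positivity), hβ j]
    refine (sobolevWasserstein_empiricalLaw_sq_le hs β j).trans_eq ?_
    congr 1
    ring
  have htend : Tendsto (fun j => sobolevWasserstein s (empiricalLaw (π j)) α) atTop (𝓝 0) :=
    tendsto_of_tendsto_of_tendsto_of_le_of_le tendsto_const_nhds
      (tendsto_ofReal_div_sqrt _) (fun _ => zero_le) (hrate hα)
  have hquant : ∀ N M : ℕ+,
      sobolevWasserstein s (empiricalLaw (π N)) (empiricalLaw (π M)) ^ 2 ≤
        ENNReal.ofReal (2 * PhiSupNorm d s * (1 / (M : ℝ) + 1 / (N : ℝ))) := fun N M => by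
    rw [hα N, hα M]
    refine (sobolevWasserstein_empiricalLaw_empiricalLaw_sq_le hs α N M).trans_eq ?_
    congr 1
    ring
  have huniq : ∀ β : ProbabilityMeasure (ProbabilityMeasure E),
      (∀ j : ℕ+, π j = mixtureMarginal β j) → β = α := fun β hβ =>
    eq_of_mixtureMarginal_eq fun j => (hβ j).symm.trans (hα j)
  refine ⟨hquant, fun ε hε => ?_, α, htend, hrate hα, hα, fun j φ => ?_, fun β hβ => ?_, huniq,
    fun β hβ => huniq β fun j => eq_mixtureMarginal_of_forall_integral_eq (hβ j)⟩
  · -- for `N, M ≥ N₀` the squared distance is at most `4 ‖Φ_s‖_∞ / N₀`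
    have hlim := tendsto_ofReal_div_sqrt √(4 * PhiSupNorm d s)
    obtain ⟨N₀, hN₀⟩ := (hlim.eventually (gt_mem_nhds hε)).exists
    refine ⟨N₀, fun N M hN hM => lt_of_le_of_lt ?_ hN₀⟩
    rw [← ENNReal.pow_le_pow_left_iff two_ne_zero, ← ENNReal.ofReal_pow (by positivity), div_pow,
      Real.sq_sqrt (by positivity), Real.sq_sqrt (by positivity)]
    refine (hquant N M).trans (ENNReal.ofReal_le_ofReal ?_)
    have h0 : (0 : ℝ) < N₀ := by exact_mod_cast N₀.pos
    have hN' : 1 / (N : ℝ) ≤ 1 / N₀ := one_div_le_one_div_of_le h0 (by exact_mod_cast hN)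
    have hM' : 1 / (M : ℝ) ≤ 1 / N₀ := one_div_le_one_div_of_le h0 (by exact_mod_cast hM)
    calc 2 * PhiSupNorm d s * (1 / (M : ℝ) + 1 / (N : ℝ))
        ≤ 2 * PhiSupNorm d s * (1 / (N₀ : ℝ) + 1 / (N₀ : ℝ)) := by gcongr
      _ = _ := by ring
  · rw [hα j]
    exact integral_boundedContinuous_mixtureMarginal α φ
  · exact eq_of_mixtureMarginal_eq fun j => mixtureMarginal_eq_of_tendsto hE hβ htend j
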